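/- Fix countably infinite, pairwise disjoint sets of concept names, role names and individual names. $\mathcal{ALCO}$-concepts are given by $$C, D ::= \top \mid \bot \mid A \mid \{c\} \mid \neg C \mid C \sqcap D \mid \exists r.C,$$ with $A$ a concept name, $c$ an individual name and $r$ a role name; $\mathcal{ALC}$-concepts are those without nominals $\{c\}$. An $\mathcal{ALC}$-KB is a pair $\mathcal{K}=(\mathcal{O},\mathcal{D})$, where $\mathcal{O}$ is a finite set of inclusions $C \sqsubseteq D$ between $\mathcal{ALC}$-concepts and $\mathcal{D}$ is a finite set of facts $A(a)$, $r(a,b)$. We write $\mathrm{ind}(\mathcal{D})$ for the set of individual names in $\mathcal{D}$ and $\mathrm{sig}(\cdot)$ for the set of concept, role and individual names that occur in a syntactic object. Semantics is the usual one, without the unique name assumption; $\mathcal{K}\models C(a)$ means that $a^{\mathfrak{A}}\in C^{\mathfrak{A}}$ in every model $\mathfrak{A}$ of $\mathcal{K}$. A labeled $\mathcal{ALC}$-KB is a triple $(\mathcal{K},P,N)$ with $\mathcal{K}=(\mathcal{O},\mathcal{D})$ an $\mathcal{ALC}$-KB and $P,N\subseteq \mathrm{ind}(\mathcal{D})$ non-empty.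 For $\Sigma\subseteq \mathrm{sig}(\mathcal{K})$, it is called projectively $\mathcal{ALCO}(\Sigma)$-separable with individual names as additional helper symbols if there are a set $\Sigma_{\mathrm{help}}$ of concept names and individual names disjoint from $\mathrm{sig}(\mathcal{K})$ and an $\mathcal{ALCO}$-concept $C$ with $\mathrm{sig}(C)\subseteq \Sigma\cup\Sigma_{\mathrm{help}}$ such that $\mathcal{K}\models C(a)$ for all $a\in P$ and $\mathcal{K}\not\models C(a)$ for all $a\in N$. Theorem. The following problem is undecidable: given a labeled $\mathcal{ALC}$-KB $(\mathcal{K},P,N)$ and a signature $\Sigma\subseteq\mathrm{sig}(\mathcal{K})$, is $(\mathcal{K},P,N)$ projectively $\mathcal{ALCO}(\Sigma)$-separable with individual names as additional helper symbols? -/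

import Mathlib

/-! Syntax and semantics of the description logics ALC and ALCO, and projective separability
with signature where concept names and individual names are admitted as helper symbols.
The concept names, the role names and the individual names are three disjoint copies of `ℕ`;
below, `A` stands for a concept name, `r` for a role name, and `a`, `b`, `c` for individual names.
Finite sets that are part of an input are given by lists;
all notions below depend only on which elements occur in a list. -/

namespace DL

/-- A symbol is a concept name, a role name or an individual name. -/
inductive Symbol where
  | concept (A : ℕ)
  | role (r : ℕ)
  | ind (c : ℕ)

/-- ALCO-concepts: `⊤ | ⊥ | A | {c} | ¬ C | C ⊓ D | ∃ r. C`. -/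
inductive ALCOConcept where
  | top
  | bot
  | atom (A : ℕ)
  | nominal (c : ℕ)
  | neg (C : ALCOConcept)
  | and (C D : ALCOConcept)
  | ex (r : ℕ) (C : ALCOConcept)

/-- ALC-concepts are the ALCO-concepts without nominals. -/
def ALCOConcept.IsALC : ALCOConcept → Prop
  | .top => True
  | .bot => True
  | .atom _ => True
  | .nominal _ => False
  | .neg C => C.IsALC
  | .and C D => C.IsALC ∧ D.IsALC
  | .ex _ C => C.IsALC

/-- The symbols that occur in a concept. -/
def ALCOConcept.sig : ALCOConcept → Set Symbol
  | .top => ∅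
  | .bot => ∅
  | .atom A => {Symbol.concept A}
  | .nominal c => {Symbol.ind c}
  | .neg C => C.sig
  | .and C D => C.sig ∪ D.sig
  | .ex r C => {Symbol.role r} ∪ C.sig

/-- A concept inclusion `lhs ⊑ rhs`. -/
structure CI where
  lhs : ALCOConcept
  rhs : ALCOConcept

/-- A fact `A(a)` or `r(a, b)`. -/
inductive Fact where
  | concept (A : ℕ) (a : ℕ)
  | role (r : ℕ) (a b : ℕ)

/-- A knowledge base: an ontology and a database. -/
structure KB where
  ontology : List CI
  database : List Fact

def CI.sig (α : CI) : Set Symbol := α.lhs.sig ∪ α.rhs.sig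

/-- The individual names that occur in a fact. -/
def Fact.inds : Fact → Set ℕ
  | .concept _ a => {a}
  | .role _ a b => {a, b}

def Fact.sig : Fact → Set Symbol
  | .concept A a => {Symbol.concept A, Symbol.ind a}
  | .role r a b => {Symbol.role r, Symbol.ind a, Symbol.ind b}

/-- The individual names that occur in the database of a knowledge base. -/
def KB.inds (K : KB) : Set ℕ := {a | ∃ f ∈ K.database, a ∈ f.inds}

/-- The symbols that occur in a knowledge base. -/
def KB.sig (K : KB) : Set Symbol :=
  {s | (∃ α ∈ K.ontology, s ∈ α.sig) ∨ (∃ f ∈ K.database, s ∈ f.sig)}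

/-- The knowledge base is an ALC-knowledge base. -/
def KB.IsALC (K : KB) : Prop := ∀ α ∈ K.ontology, α.lhs.IsALC ∧ α.rhs.IsALC

/-- Interpretations. Distinct individual names may denote the same element. The domain is
non-empty because it contains the denotations of the individual names. -/
structure Interp where
  dom : Type
  concept : ℕ → Set dom
  role : ℕ → dom → dom → Prop
  ind : ℕ → dom

/-- The extension of a concept. -/
def ALCOConcept.ext (M : Interp) : ALCOConcept → Set M.dom
  | .top => Set.univ
  | .bot => ∅
  | .atom A => M.concept A
  | .nominal c => {M.ind c}
  | .neg C => (C.ext M)ᶜ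
  | .and C D => C.ext M ∩ D.ext M
  | .ex r C => {d | ∃ e, M.role r d e ∧ e ∈ C.ext M}

def Interp.SatCI (M : Interp) (α : CI) : Prop := α.lhs.ext M ⊆ α.rhs.ext M

def Interp.SatFact (M : Interp) : Fact → Prop
  | .concept A a => M.ind a ∈ M.concept A
  | .role r a b => M.role r (M.ind a) (M.ind b)

def Interp.IsModel (M : Interp) (K : KB) : Prop :=
  (∀ α ∈ K.ontology, M.SatCI α) ∧ (∀ f ∈ K.database, M.SatFact f)

/-- `K ⊨ C(a)`. -/
def KB.Entails (K : KB) (C : ALCOConcept) (a : ℕ) : Prop :=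
  ∀ M : Interp, M.IsModel K → M.ind a ∈ C.ext M

/-- An input of the separability problem: a knowledge base `K`, positive examples, negative
examples, and a signature. -/
structure Input where
  K : KB
  pos : List ℕ
  neg : List ℕ
  sgn : List Symbol

/-- `(K, P, N)` is a labeled ALC-knowledge base and `Σ ⊆ sig(K)`. -/
structure Input.Valid (I : Input) : Prop where
  isALC : I.K.IsALC
  pos_nonempty : I.pos ≠ []
  neg_nonempty : I.neg ≠ []
  pos_subset : ∀ a ∈ I.pos, a ∈ I.K.inds
  neg_subset : ∀ a ∈ I.neg, a ∈ I.K.inds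
  sgn_subset : ∀ s ∈ I.sgn, s ∈ I.K.sig

/-- The concept `C` separates `(K, P, N)` in the weak sense. -/
def Input.SeparatedBy (I : Input) (C : ALCOConcept) : Prop :=
  (∀ a ∈ I.pos, I.K.Entails C a) ∧ (∀ a ∈ I.neg, ¬ I.K.Entails C a)

/-- `(K, P, N)` is projectively ALCO(Σ)-separable where concept names and individual names are
admitted as helper symbols: some ALCO-concept that uses only symbols from `Σ` and from a set of
concept and individual names disjoint from `sig(K)` separates `(K, P, N)`. -/
def Input.SeparableWithIndHelpers (I : Input) : Prop :=
  ∃ help : Set Symbol,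
    help ⊆ Set.range Symbol.concept ∪ Set.range Symbol.ind ∧
    Disjoint help I.K.sig ∧
    ∃ C : ALCOConcept, C.sig ⊆ {s | s ∈ I.sgn} ∪ help ∧ I.SeparatedBy C

/-! Gödel numberings, so that computability of functions on inputs makes sense. -/

/-- The Gödel number of a concept. -/
def ALCOConcept.toNat : ALCOConcept → ℕ
  | .top => 0
  | .bot => 1
  | .atom A => 5 * A + 2
  | .nominal c => 5 * c + 3
  | .neg C => 5 * C.toNat + 4
  | .and C D => 5 * Nat.pair C.toNat D.toNat + 5
  | .ex r C => 5 * Nat.pair r C.toNat + 6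

/-- The concept with a given Gödel number. -/
def ALCOConcept.ofNat : ℕ → ALCOConcept
  | 0 => .top
  | 1 => .bot
  | n + 2 =>
    have h0 : n / 5 < n + 2 := by omega
    have h1 : (n / 5).unpair.1 < n + 2 := lt_of_le_of_lt (Nat.unpair_left_le _) h0
    have h2 : (n / 5).unpair.2 < n + 2 := lt_of_le_of_lt (Nat.unpair_right_le _) h0
    if n % 5 = 0 then .atom (n / 5)
    else if n % 5 = 1 then .nominal (n / 5)
    else if n % 5 = 2 then .neg (ALCOConcept.ofNat (n / 5))
    else if n % 5 = 3 then
      .and (ALCOConcept.ofNat (n / 5).unpair.1) (ALCOConcept.ofNat (n / 5).unpair.2)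
    else .ex (n / 5).unpair.1 (ALCOConcept.ofNat (n / 5).unpair.2)

theorem ALCOConcept.ofNat_toNat (C : ALCOConcept) : ALCOConcept.ofNat C.toNat = C := by
  induction C with
  | top => simp [ALCOConcept.toNat, ALCOConcept.ofNat]
  | bot => simp [ALCOConcept.toNat, ALCOConcept.ofNat]
  | atom A =>
    have h1 : 5 * A % 5 = 0 := by omega
    have h2 : 5 * A / 5 = A := by omega
    simp [ALCOConcept.toNat, ALCOConcept.ofNat]
  | nominal c =>
    have h1 : (5 * c + 1) % 5 = 1 := by omega
    have h2 : (5 * c + 1) / 5 = c := by omega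
    simp [ALCOConcept.toNat, ALCOConcept.ofNat, h1, h2]
  | neg C ih =>
    have h1 : (5 * C.toNat + 2) % 5 = 2 := by omega
    have h2 : (5 * C.toNat + 2) / 5 = C.toNat := by omega
    simp [ALCOConcept.toNat, ALCOConcept.ofNat, h1, h2, ih]
  | and C D ihC ihD =>
    have h1 : (5 * Nat.pair C.toNat D.toNat + 3) % 5 = 3 := by omega
    have h2 : (5 * Nat.pair C.toNat D.toNat + 3) / 5 = Nat.pair C.toNat D.toNat := by omega
    simp [ALCOConcept.toNat, ALCOConcept.ofNat, h1, h2, ihC, ihD]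
  | ex r C ih =>
    have h1 : (5 * Nat.pair r C.toNat + 4) % 5 = 4 := by omega
    have h2 : (5 * Nat.pair r C.toNat + 4) / 5 = Nat.pair r C.toNat := by omega
    simp [ALCOConcept.toNat, ALCOConcept.ofNat, h1, h2, ih]

theorem ALCOConcept.toNat_ofNat (n : ℕ) : (ALCOConcept.ofNat n).toNat = n := by
  induction n using Nat.strong_induction_on with
  | _ n ih =>
    match n, ih with
    | 0, _ => simp [ALCOConcept.ofNat, ALCOConcept.toNat]
    | 1, _ => simp [ALCOConcept.ofNat, ALCOConcept.toNat]
    | n + 2, ih =>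
      have h0 : n / 5 < n + 2 := by omega
      have h1 : (n / 5).unpair.1 < n + 2 := lt_of_le_of_lt (Nat.unpair_left_le _) h0
      have h2 : (n / 5).unpair.2 < n + 2 := lt_of_le_of_lt (Nat.unpair_right_le _) h0
      rw [ALCOConcept.ofNat]
      split_ifs with c0 c1 c2 c3
      · simp only [ALCOConcept.toNat]; omega
      · simp only [ALCOConcept.toNat]; omega
      · simp only [ALCOConcept.toNat, ih _ h0]; omega
      · simp only [ALCOConcept.toNat, ih _ h1, ih _ h2, Nat.pair_unpair]; omega
      · simp only [ALCOConcept.toNat, ih _ h2, Nat.pair_unpair]; omega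

def ALCOConcept.equivNat : ALCOConcept ≃ ℕ where
  toFun := ALCOConcept.toNat
  invFun := ALCOConcept.ofNat
  left_inv := ALCOConcept.ofNat_toNat
  right_inv := ALCOConcept.toNat_ofNat

instance : Primcodable ALCOConcept := Primcodable.ofEquiv ℕ ALCOConcept.equivNat

def Symbol.equivSum : Symbol ≃ ℕ ⊕ ℕ ⊕ ℕ where
  toFun s := match s with
    | .concept A => Sum.inl A
    | .role r => Sum.inr (Sum.inl r)
    | .ind c => Sum.inr (Sum.inr c)
  invFun s := match s with
    | Sum.inl A => .concept A
    | Sum.inr (Sum.inl r) => .role r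
    | Sum.inr (Sum.inr c) => .ind c
  left_inv s := by cases s <;> rfl
  right_inv s := by rcases s with A | r | c <;> rfl

instance : Primcodable Symbol :=
  Primcodable.ofEquiv (ℕ ⊕ ℕ ⊕ ℕ) Symbol.equivSum

def Fact.equivSum : Fact ≃ (ℕ × ℕ) ⊕ (ℕ × ℕ × ℕ) where
  toFun f := match f with
    | .concept A a => Sum.inl (A, a)
    | .role r a b => Sum.inr (r, a, b)
  invFun f := match f with
    | Sum.inl (A, a) => .concept A a
    | Sum.inr (r, a, b) => .role r a b
  left_inv f := by cases f <;> rfl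
  right_inv f := by rcases f with ⟨A, a⟩ | ⟨r, a, b⟩ <;> rfl

instance : Primcodable Fact :=
  Primcodable.ofEquiv ((ℕ × ℕ) ⊕ (ℕ × ℕ × ℕ)) Fact.equivSum

def CI.equivProd : CI ≃ ALCOConcept × ALCOConcept where
  toFun α := (α.lhs, α.rhs)
  invFun p := ⟨p.1, p.2⟩
  left_inv _ := rfl
  right_inv _ := rfl

instance : Primcodable CI := Primcodable.ofEquiv (ALCOConcept × ALCOConcept) CI.equivProd

def KB.equivProd : KB ≃ List CI × List Fact where
  toFun K := (K.ontology, K.database)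
  invFun p := ⟨p.1, p.2⟩
  left_inv _ := rfl
  right_inv _ := rfl

instance : Primcodable KB := Primcodable.ofEquiv (List CI × List Fact) KB.equivProd

def Input.equivProd : Input ≃ KB × List ℕ × List ℕ × List Symbol where
  toFun I := (I.K, I.pos, I.neg, I.sgn)
  invFun p := ⟨p.1, p.2.1, p.2.2.1, p.2.2.2⟩
  left_inv _ := rfl
  right_inv _ := rfl

instance : Primcodable Input :=
  Primcodable.ofEquiv (KB × List ℕ × List ℕ × List Symbol) Input.equivProd

end DL

/-!
The halting problem is reduced to separability. Let `c` be a code for partial recursive functions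
on lists of numbers (`Turing.ToPartrec.Code`) and `[n]` an input. A halting computation has a
finite derivation tree in the big-step semantics of codes. The tree is represented by a structure
with seven roles: a run has an input, an output and up to two sub-runs, a list has a head and a
tail, and a number has a predecessor. Each rule of the semantics says locally that certain
successors exist and that certain pairs of paths lead to the same element.

An ALC-ontology cannot express that two paths lead to the same element, but it can express the
opposite: with a concept name `P` outside the signature, `∃ path₁. P ⊓ ∃ path₂. ¬ P` is
satisfiable by a choice of `P` if and only if the paths can lead to distinct elements. Hence there
is a concept `defect c` stating that a run of `c` violates some rule, either itself or in a sub-run;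
the unbounded iteration in `fix f` is followed by a concept name that is governed by an inclusion.
In the knowledge base `reduction c n`, the positive example must be defective if its input is
`[n]`, whereas the negative example is unconstrained.

* If `c` halts on `[n]`, then, with an individual name for every number and every list, a concept
  can describe the derivation tree so precisely that all required equalities hold
  (`exists_describesRun`). The description is satisfiable at the negative example
  (`intended_isModel`), and contradicts the defect at the positive one. Its complement separates
  (`separable_of_mem_eval`).
* Conversely, let a concept separate, and take a model in which it fails at the negative example.
  Moving the positive example to that element and reinterpreting the concept names of the knowledge
  base cannot yield a model, so the element has input `[n]` and cannot be made defective. A run that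
  cannot be made defective is correct (`sound_of_not_defective`): all equalities hold, and there is
  no infinite chain of iterations, since such a chain could itself be declared a defect
  (`acc_of_not_defective`). So the structure contains a halting computation
  (`eval_dom_of_separable`).
-/

namespace DL

open Turing.ToPartrec (Code)

/-! ### Evaluation of codes as a relation -/

theorem mem_eval_zero' {v w : List ℕ} : w ∈ Code.zero'.eval v ↔ w = 0 :: v := by
  simp [Code.zero'_eval]

theorem mem_eval_succ {v w : List ℕ} : w ∈ Code.succ.eval v ↔ w = [v.headI + 1] := by
  simp [Code.succ_eval]

theorem mem_eval_tail {v w : List ℕ} : w ∈ Code.tail.eval v ↔ w = v.tail := by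
  simp [Code.tail_eval]

theorem mem_eval_cons {f g : Code} {v w : List ℕ} :
    w ∈ (f.cons g).eval v ↔ ∃ a ∈ f.eval v, ∃ b ∈ g.eval v, w = a.headI :: b := by
  simp [Code.cons_eval]

theorem mem_eval_comp {f g : Code} {v w : List ℕ} :
    w ∈ (f.comp g).eval v ↔ ∃ u ∈ g.eval v, w ∈ f.eval u := by
  rw [Code.comp_eval]
  exact Part.mem_bind_iff

theorem eval_case_of_zero {f g : Code} {v : List ℕ} (h : v.headI = 0) :
    (f.case g).eval v = f.eval v.tail := by
  simp [Code.case_eval, h]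

theorem eval_case_of_succ {f g : Code} {v : List ℕ} {n : ℕ} (h : v.headI = n + 1) :
    (f.case g).eval v = g.eval (n :: v.tail) := by
  simp [Code.case_eval, h]

theorem mem_eval_fix {f : Code} {v w : List ℕ} :
    w ∈ f.fix.eval v ↔ ∃ u ∈ f.eval v,
      (u.headI = 0 ∧ w = u.tail) ∨ (u.headI ≠ 0 ∧ w ∈ f.fix.eval u.tail) := by
  rw [Code.fix_eval]
  refine PFun.mem_fix_iff.trans ?_
  simp only [Part.mem_map_iff]
  constructor
  · rintro (⟨u, hu, h⟩ | ⟨a, ⟨u, hu, h⟩, hw⟩)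
    · refine ⟨u, hu, Or.inl ?_⟩
      split_ifs at h with h0
      exact ⟨h0, (Sum.inl.inj h).symm⟩
    · refine ⟨u, hu, Or.inr ?_⟩
      split_ifs at h with h0
      obtain rfl := Sum.inr.inj h
      exact ⟨h0, hw⟩
  · rintro ⟨u, hu, ⟨h0, rfl⟩ | ⟨h0, hw⟩⟩
    · exact Or.inl ⟨u, hu, if_pos h0⟩
    · exact Or.inr ⟨u.tail, ⟨u, hu, if_neg h0⟩, hw⟩

/-- A Gödel numbering of codes, used to index concept names. -/
def codeIdx : Code → ℕ
  | .zero' => 0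
  | .succ => 1
  | .tail => 2
  | .cons f g => 4 * Nat.pair (codeIdx f) (codeIdx g) + 3
  | .comp f g => 4 * Nat.pair (codeIdx f) (codeIdx g) + 4
  | .case f g => 4 * Nat.pair (codeIdx f) (codeIdx g) + 5
  | .fix f => 4 * codeIdx f + 6

theorem codeIdx_injective : Function.Injective codeIdx := by
  intro c
  induction c with
  | zero' => intro d h; cases d <;> simp only [codeIdx] at h <;> first | rfl | omega
  | succ => intro d h; cases d <;> simp only [codeIdx] at h <;> first | rfl | omega
  | tail => intro d h; cases d <;> simp only [codeIdx] at h <;> first | rfl | omega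
  | fix f ih =>
    intro d h
    cases d <;> simp only [codeIdx] at h <;> try omega
    rename_i g
    rw [ih (by omega : codeIdx f = codeIdx g)]
  | _ f g ihf ihg =>
    intro d h
    cases d <;> simp only [codeIdx] at h <;> try omega
    rename_i f' g'
    obtain ⟨h1, h2⟩ := Nat.pair_eq_pair.1
      (by omega : Nat.pair (codeIdx f) (codeIdx g) = Nat.pair (codeIdx f') (codeIdx g'))
    rw [ihf h1, ihg h2]

/-! ### Derived concept constructors and their semantics -/

namespace ALCOConcept

/-- Disjunction of a list of concepts. -/
def anyOf : List ALCOConcept → ALCOConcept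
  | [] => bot
  | C :: l => neg (and (neg C) (neg (anyOf l)))

/-- `∀ r. C`. -/
def all (r : ℕ) (C : ALCOConcept) : ALCOConcept := neg (ex r (neg C))

/-- There is an `r`-successor, and all of them satisfy `C`. -/
def the (r : ℕ) (C : ALCOConcept) : ALCOConcept := and (ex r top) (all r C)

variable {M : Interp} {x : M.dom} {C D : ALCOConcept} {r : ℕ}

@[simp] theorem mem_top : x ∈ top.ext M := trivial
@[simp] theorem mem_bot : x ∈ bot.ext M ↔ False := Iff.rfl
@[simp] theorem mem_atom {A : ℕ} : x ∈ (atom A).ext M ↔ x ∈ M.concept A := Iff.rfl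
@[simp] theorem mem_neg : x ∈ (neg C).ext M ↔ x ∉ C.ext M := Iff.rfl
@[simp] theorem mem_and : x ∈ (and C D).ext M ↔ x ∈ C.ext M ∧ x ∈ D.ext M := Iff.rfl
@[simp] theorem mem_ex : x ∈ (ex r C).ext M ↔ ∃ y, M.role r x y ∧ y ∈ C.ext M := Iff.rfl

@[simp] theorem mem_anyOf {l : List ALCOConcept} :
    x ∈ (anyOf l).ext M ↔ ∃ C ∈ l, x ∈ C.ext M := by
  induction l with
  | nil => simp [anyOf]
  | cons C l ih =>
    simp only [anyOf, mem_neg, mem_and, ih, List.mem_cons, exists_eq_or_imp, not_and_or,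
      not_not]

@[simp] theorem mem_the :
    x ∈ (the r C).ext M ↔ (∃ y, M.role r x y) ∧ ∀ y, M.role r x y → y ∈ C.ext M := by
  simp [the, all]

theorem isALC_anyOf {l : List ALCOConcept} (h : ∀ C ∈ l, C.IsALC) : (anyOf l).IsALC := by
  induction l with
  | nil => trivial
  | cons C l ih =>
    exact ⟨h C (by simp), ih fun D hD => h D (by simp [hD])⟩

theorem ind_notMem_sig_of_isALC {c : ℕ} (h : C.IsALC) : Symbol.ind c ∉ C.sig := by
  induction C with
  | nominal => exact h.elim
  | and C D ihC ihD => simp [sig, ihC h.1, ihD h.2]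
  | neg C ih => exact ih h
  | ex r C ih => simp [sig, ih h]
  | _ => simp [sig]

/-- The extension of a concept depends only on the interpretation of the symbols that occur in
the concept. -/
theorem ext_congr {M : Interp} {concept' : ℕ → Set M.dom} {ind' : ℕ → M.dom} {C : ALCOConcept}
    (hA : ∀ A, Symbol.concept A ∈ C.sig → concept' A = M.concept A)
    (hc : ∀ c, Symbol.ind c ∈ C.sig → ind' c = M.ind c) :
    C.ext ⟨M.dom, concept', M.role, ind'⟩ = C.ext M := by
  induction C with
  | top => rfl
  | bot => rfl
  | atom A => exact hA A rfl
  | nominal c => exact congrArg _ (hc c rfl)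
  | neg C ih => exact congrArg _ (ih hA hc)
  | and C D ihC ihD =>
    exact congrArg₂ _ (ihC (fun A h => hA A (Or.inl h)) fun c h => hc c (Or.inl h))
      (ihD (fun A h => hA A (Or.inr h)) fun c h => hc c (Or.inr h))
  | ex r C ih =>
    have := ih (fun A h => hA A (Or.inr h)) fun c h => hc c (Or.inr h)
    simp only [ext, this]

end ALCOConcept

/-- `M` with another interpretation of the concept names. -/
abbrev Interp.withConcepts (M : Interp) (V : ℕ → Set M.dom) : Interp :=
  ⟨M.dom, V, M.role, M.ind⟩

/-! ### Lists of numbers as role structures -/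

/-- From a run to its input list. -/
abbrev roleIn : ℕ := 0
/-- From a run to its output list. -/
abbrev roleOut : ℕ := 1
/-- From a run to its first sub-run. -/
abbrev roleFst : ℕ := 2
/-- From a run to its second sub-run. -/
abbrev roleSnd : ℕ := 3
/-- From a list to its head, which is a number. -/
abbrev roleHead : ℕ := 4
/-- From a list to its tail. -/
abbrev roleTail : ℕ := 5
/-- From a number to its predecessor. -/
abbrev rolePred : ℕ := 6

/-- `x` represents the number `n`: some chain of predecessors of length `n` starts at `x` and ends
in an element without predecessor. Roles need not be functional, so an element may represent
several numbers. -/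
def IsNum {α : Type} (R : ℕ → α → α → Prop) : ℕ → α → Prop
  | 0, x => ¬ ∃ y, R rolePred x y
  | n + 1, x => ∃ y, R rolePred x y ∧ IsNum R n y

/-- `x` represents a list. The empty list has no tail, but a head `0`, in accordance with
`List.headI`. -/
def IsList {α : Type} (R : ℕ → α → α → Prop) : List ℕ → α → Prop
  | [], x => (¬ ∃ y, R roleTail x y) ∧ ∃ y, R roleHead x y ∧ IsNum R 0 y
  | n :: v, x => (∃ y, R roleHead x y ∧ IsNum R n y) ∧ ∃ y, R roleTail x y ∧ IsList R v y

/-- `y` is a tail of `x`, where an element without tail counts as its own tail, in accordance with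
`List.tail`. -/
def IsTail {α : Type} (R : ℕ → α → α → Prop) (x y : α) : Prop :=
  R roleTail x y ∨ (¬ ∃ z, R roleTail x z) ∧ x = y

theorem IsList.head {α : Type} {R : ℕ → α → α → Prop} {v : List ℕ} {x : α} (h : IsList R v x) :
    ∃ y, R roleHead x y ∧ IsNum R v.headI y := by
  cases v with
  | nil => exact h.2
  | cons n v => exact h.1

theorem IsList.tail {α : Type} {R : ℕ → α → α → Prop} {v : List ℕ} {x : α} (h : IsList R v x) :
    ∃ y, IsTail R x y ∧ IsList R v.tail y := by
  cases v with
  | nil => exact ⟨x, Or.inr ⟨h.1, rfl⟩, h⟩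
  | cons n v =>
    obtain ⟨y, hy, hv⟩ := h.2
    exact ⟨y, Or.inl hy, hv⟩

namespace ALCOConcept

/-- The number `0`. -/
def zero : ALCOConcept := neg (ex rolePred top)

/-- A positive number. -/
def positive : ALCOConcept := ex rolePred top

/-- The number `n`. -/
def num : ℕ → ALCOConcept
  | 0 => zero
  | n + 1 => ex rolePred (num n)

/-- The empty list. -/
def emptyList : ALCOConcept := and (neg (ex roleTail top)) (ex roleHead zero)

/-- Some tail, in the sense of `IsTail`, satisfies `C`. -/
def exTail (C : ALCOConcept) : ALCOConcept :=
  anyOf [ex roleTail C, and (neg (ex roleTail top)) C]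

/-- An element with both a head and a tail. -/
def isCons : ALCOConcept := and (ex roleHead top) (ex roleTail top)

/-- The concept name whose complement witnesses that two elements are distinct. -/
abbrev testName : ℕ := 2

/-- `F` and `G` are existential restrictions along two paths. If the interpretation of `testName`
can be chosen freely, the concept says that the paths lead to two distinct elements. -/
def differ (F G : ALCOConcept → ALCOConcept) : ALCOConcept :=
  and (F (atom testName)) (G (neg (atom testName)))

variable {M : Interp} {x : M.dom} {C D : ALCOConcept} {r : ℕ}

@[simp] theorem mem_zero : x ∈ zero.ext M ↔ IsNum M.role 0 x := by
  simp [zero, IsNum]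

@[simp] theorem mem_positive : x ∈ positive.ext M ↔ ∃ y, M.role rolePred x y := by
  simp [positive]

@[simp] theorem mem_num {n : ℕ} : x ∈ (num n).ext M ↔ IsNum M.role n x := by
  induction n generalizing x with
  | zero => exact mem_zero
  | succ n ih => simp [num, ih, IsNum]

@[simp] theorem mem_emptyList : x ∈ emptyList.ext M ↔ IsList M.role [] x := by
  simp [emptyList, IsList]

@[simp] theorem mem_exTail :
    x ∈ (exTail C).ext M ↔ ∃ y, IsTail M.role x y ∧ y ∈ C.ext M := by
  simp only [exTail, mem_anyOf, List.mem_cons, List.not_mem_nil, or_false, exists_eq_or_imp,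
    exists_eq_left, mem_ex, mem_and, mem_neg, mem_top, and_true, IsTail]
  constructor
  · rintro (⟨y, h, hC⟩ | ⟨h, hC⟩)
    · exact ⟨y, Or.inl h, hC⟩
    · exact ⟨x, Or.inr ⟨h, rfl⟩, hC⟩
  · rintro ⟨y, h | ⟨h, rfl⟩, hC⟩
    · exact Or.inl ⟨y, h, hC⟩
    · exact Or.inr ⟨h, hC⟩

@[simp] theorem mem_isCons :
    x ∈ isCons.ext M ↔ (∃ y, M.role roleHead x y) ∧ ∃ y, M.role roleTail x y := by
  simp [isCons]

@[simp] theorem mem_differ {F G : ALCOConcept → ALCOConcept} :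
    x ∈ (differ F G).ext M ↔
      x ∈ (F (atom testName)).ext M ∧ x ∈ (G (neg (atom testName))).ext M := Iff.rfl

end ALCOConcept

/-! ### Defects of runs -/

open ALCOConcept

/-- The concept name for defective runs of `fix f`. -/
def defectName (f : Code) : ℕ := codeIdx f.fix + 3

/-- The concept "this is not a correct run of the code": some required successor is missing, two
paths that must lead to the same element do not, or a sub-run is defective. The recursion on codes
stops at `fix f`, whose runs have runs of `fix f` as second sub-runs; there a concept name stands
for the concept `fixDefect f`. -/
def defect : Code → ALCOConcept
  | .zero' => anyOf [
      neg (ex roleOut (and (ex roleHead zero) (ex roleTail top))),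
      differ (fun X => ex roleOut (ex roleTail X)) (ex roleIn)]
  | .succ => anyOf [
      neg (ex roleOut (and (ex roleHead positive) (ex roleTail emptyList))),
      differ (fun X => ex roleOut (ex roleHead (ex rolePred X)))
        (fun X => ex roleIn (ex roleHead X))]
  | .tail => anyOf [
      neg (ex roleOut top),
      differ (ex roleOut) (fun X => ex roleIn (exTail X))]
  | .cons f g => anyOf [
      neg (ex roleFst (ex roleIn top)),
      differ (fun X => ex roleFst (ex roleIn X)) (ex roleIn),
      ex roleFst (defect f),
      neg (ex roleSnd (ex roleIn top)),
      differ (fun X => ex roleSnd (ex roleIn X)) (ex roleIn),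
      ex roleSnd (defect g),
      neg (ex roleOut isCons),
      differ (fun X => ex roleOut (ex roleHead X))
        (fun X => ex roleFst (ex roleOut (ex roleHead X))),
      differ (fun X => ex roleOut (ex roleTail X)) (fun X => ex roleSnd (ex roleOut X))]
  | .comp f g => anyOf [
      neg (ex roleFst (ex roleIn top)),
      differ (fun X => ex roleFst (ex roleIn X)) (ex roleIn),
      ex roleFst (defect g),
      neg (ex roleSnd (ex roleIn top)),
      differ (fun X => ex roleSnd (ex roleIn X)) (fun X => ex roleFst (ex roleOut X)),
      ex roleSnd (defect f),
      neg (ex roleOut top),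
      differ (ex roleOut) (fun X => ex roleSnd (ex roleOut X))]
  | .case f g => anyOf [
      neg (ex roleFst (ex roleIn top)),
      neg (ex roleOut top),
      differ (ex roleOut) (fun X => ex roleFst (ex roleOut X)),
      and (ex roleIn (ex roleHead zero))
        (differ (fun X => ex roleFst (ex roleIn X)) (fun X => ex roleIn (exTail X))),
      and (ex roleIn (ex roleHead zero)) (ex roleFst (defect f)),
      and (ex roleIn (ex roleHead positive)) (neg (ex roleFst (ex roleIn isCons))),
      and (ex roleIn (ex roleHead positive))
        (differ (fun X => ex roleFst (ex roleIn (ex roleHead X)))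
          (fun X => ex roleIn (ex roleHead (ex rolePred X)))),
      and (ex roleIn (ex roleHead positive))
        (differ (fun X => ex roleFst (ex roleIn (ex roleTail X)))
          (fun X => ex roleIn (exTail X))),
      and (ex roleIn (ex roleHead positive)) (ex roleFst (defect g))]
  | .fix f => atom (defectName f)

/-- The concept "this is not a correct run of `fix f`". -/
def fixDefect (f : Code) : ALCOConcept := anyOf [
  neg (ex roleFst (ex roleIn top)),
  differ (fun X => ex roleFst (ex roleIn X)) (ex roleIn),
  ex roleFst (defect f),
  neg (ex roleOut top),
  and (ex roleFst (ex roleOut (ex roleHead zero)))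
    (differ (ex roleOut) (fun X => ex roleFst (ex roleOut (exTail X)))),
  and (ex roleFst (ex roleOut (ex roleHead positive))) (neg (ex roleSnd (ex roleIn top))),
  and (ex roleFst (ex roleOut (ex roleHead positive)))
    (differ (fun X => ex roleSnd (ex roleIn X)) (fun X => ex roleFst (ex roleOut (exTail X)))),
  and (ex roleFst (ex roleOut (ex roleHead positive))) (ex roleSnd (defect f.fix)),
  and (ex roleFst (ex roleOut (ex roleHead positive)))
    (differ (ex roleOut) (fun X => ex roleSnd (ex roleOut X)))]

/-- The inclusion that governs the concept name for defective runs of `fix f`. -/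
def fixCI (f : Code) : CI := ⟨atom (defectName f), fixDefect f⟩

/-- The inclusions for all subcodes of a code that have the form `fix f`. -/
def fixCIs : Code → List CI
  | .zero' => []
  | .succ => []
  | .tail => []
  | .cons f g => fixCIs f ++ fixCIs g
  | .comp f g => fixCIs f ++ fixCIs g
  | .case f g => fixCIs f ++ fixCIs g
  | .fix f => fixCI f :: fixCIs f

theorem isALC_defect (c : Code) : (defect c).IsALC := by
  induction c with
  | fix => trivial
  | _ =>
    refine isALC_anyOf ?_
    simp_all [IsALC, differ, exTail, anyOf, zero, positive, emptyList, isCons]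

theorem isALC_fixDefect (f : Code) : (fixDefect f).IsALC := by
  refine isALC_anyOf ?_
  simp [IsALC, differ, exTail, anyOf, zero, positive, isALC_defect]

theorem exists_eq_fixCI_of_mem_fixCIs {c : Code} {α : CI} (h : α ∈ fixCIs c) :
    ∃ f, α = fixCI f := by
  induction c with
  | fix f ih =>
    rcases List.mem_cons.1 h with h | h
    · exact ⟨f, h⟩
    · exact ih h
  | _ => simp_all [fixCIs] <;> tauto

/-! ### Describing a halting run by a concept with nominals -/

/-- The helper individual name for a number. -/
def numName (n : ℕ) : ℕ := 2 * n + 2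

/-- The helper individual name for a list. -/
def listName (v : List ℕ) : ℕ := 2 * Encodable.encode v + 3

namespace ALCOConcept

/-- The element named `numName n`, with a description of its predecessors. -/
def theNum : ℕ → ALCOConcept
  | 0 => and (nominal (numName 0)) zero
  | n + 1 => and (nominal (numName (n + 1))) (the rolePred (theNum n))

/-- The element named `listName v`, with a description of its heads and tails. -/
def theList : List ℕ → ALCOConcept
  | [] => and (nominal (listName [])) (and (the roleHead (theNum 0)) (neg (ex roleTail top)))
  | n :: v => and (nominal (listName (n :: v)))
      (and (the roleHead (theNum n)) (the roleTail (theList v)))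

variable {M : Interp} {x y : M.dom}

theorem eq_of_mem_theNum {n : ℕ} (hx : x ∈ (theNum n).ext M) (hy : y ∈ (theNum n).ext M) :
    x = y := by
  cases n <;> exact hx.1.trans hy.1.symm

theorem eq_of_mem_theList {v : List ℕ} (hx : x ∈ (theList v).ext M)
    (hy : y ∈ (theList v).ext M) : x = y := by
  cases v <;> exact hx.1.trans hy.1.symm

theorem isNum_of_mem_theNum {n : ℕ} (hx : x ∈ (theNum n).ext M) : IsNum M.role n x := by
  induction n generalizing x with
  | zero => exact mem_zero.1 hx.2
  | succ n ih =>
    obtain ⟨⟨y, hy⟩, h⟩ := mem_the.1 hx.2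
    exact ⟨y, hy, ih (h y hy)⟩

theorem mem_theNum_pred {n : ℕ} (hx : x ∈ (theNum n).ext M) (h : M.role rolePred x y) :
    ∃ m, n = m + 1 ∧ y ∈ (theNum m).ext M := by
  cases n with
  | zero => exact ((mem_zero.1 hx.2) ⟨y, h⟩).elim
  | succ n => exact ⟨n, rfl, (mem_the.1 hx.2).2 y h⟩

theorem mem_theList_head {v : List ℕ} (hx : x ∈ (theList v).ext M) (h : M.role roleHead x y) :
    y ∈ (theNum v.headI).ext M := by
  cases v <;> exact (mem_the.1 hx.2.1).2 y h

theorem exists_head_of_mem_theList {v : List ℕ} (hx : x ∈ (theList v).ext M) :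
    ∃ y, M.role roleHead x y := by
  cases v <;> exact (mem_the.1 hx.2.1).1

theorem exists_tail_of_mem_theList {n : ℕ} {v : List ℕ} (hx : x ∈ (theList (n :: v)).ext M) :
    ∃ y, M.role roleTail x y :=
  (mem_the.1 hx.2.2).1

theorem mem_theList_tail {v : List ℕ} (hx : x ∈ (theList v).ext M) (h : M.role roleTail x y) :
    y ∈ (theList v.tail).ext M := by
  cases v with
  | nil => exact (hx.2.2 ⟨y, h, trivial⟩).elim
  | cons n v => exact (mem_the.1 hx.2.2).2 y h

theorem mem_theList_isTail {v : List ℕ} (hx : x ∈ (theList v).ext M) (h : IsTail M.role x y) :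
    y ∈ (theList v.tail).ext M := by
  rcases h with h | ⟨h, rfl⟩
  · exact mem_theList_tail hx h
  · cases v with
    | nil => exact hx
    | cons n v => exact (h (exists_tail_of_mem_theList hx)).elim

theorem isList_of_mem_theList {v : List ℕ} (hx : x ∈ (theList v).ext M) :
    IsList M.role v x := by
  induction v generalizing x with
  | nil =>
    obtain ⟨y, hy⟩ := exists_head_of_mem_theList hx
    exact ⟨fun ⟨z, hz⟩ => hx.2.2 ⟨z, hz, trivial⟩,
      y, hy, isNum_of_mem_theNum (mem_theList_head hx hy)⟩
  | cons n v ih =>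
    obtain ⟨y, hy⟩ := exists_head_of_mem_theList hx
    obtain ⟨z, hz⟩ := exists_tail_of_mem_theList hx
    exact ⟨⟨y, hy, isNum_of_mem_theNum (mem_theList_head hx hy)⟩,
      z, hz, ih (mem_theList_tail hx hz)⟩

end ALCOConcept

/-- The elements of the intended structure: numbers, lists, and runs, where a run is given by a
code and an input. -/
inductive Node where
  | num (n : ℕ)
  | list (v : List ℕ)
  | run (c : Code) (v : List ℕ)

/-- The first sub-run of a run. -/
def Node.fst : Node → Node → Prop
  | .run (.cons f _) v, y => y = .run f v
  | .run (.comp _ g) v, y => y = .run g v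
  | .run (.case f g) v, y =>
      (v.headI = 0 ∧ y = .run f v.tail) ∨ ∃ n, v.headI = n + 1 ∧ y = .run g (n :: v.tail)
  | .run (.fix f) v, y => y = .run f v
  | _, _ => False

/-- The second sub-run of a run. -/
def Node.snd : Node → Node → Prop
  | .run (.cons _ g) v, y => y = .run g v
  | .run (.comp f g) v, y => ∃ u ∈ g.eval v, y = .run f u
  | .run (.fix f) v, y => ∃ u ∈ f.eval v, u.headI ≠ 0 ∧ y = .run f.fix u.tail
  | _, _ => False

/-- The roles of the intended structure. -/
def Node.role : ℕ → Node → Node → Prop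
  | 0, .run _ v, y => y = .list v
  | 1, .run c v, y => ∃ w ∈ c.eval v, y = .list w
  | 2, x, y => x.fst y
  | 3, x, y => x.snd y
  | 4, .list v, y => y = .num v.headI
  | 5, .list (_ :: v), y => y = .list v
  | 6, .num (n + 1), y => y = .num n
  | _, _, _ => False

/-- The intended structure. The individual name `1` of the negative example denotes a given node,
while the individual name `0` of the positive example denotes a node that is no run and hence
escapes all requirements on runs. -/
@[reducible] def intended (root : Node) : Interp where
  dom := Node
  concept A := match A with
    | 0 => {Node.num 0}
    | 1 => Set.univ
    | _ => ∅
  role := Node.role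
  ind c := match c with
    | 0 => .num 0
    | 1 => root
    | k + 2 => if k % 2 = 0 then .num (k / 2) else .list (Denumerable.ofNat (List ℕ) (k / 2))

theorem intended_ind_numName (root : Node) (n : ℕ) :
    (intended root).ind (numName n) = .num n := by
  simp [numName]

theorem intended_ind_listName (root : Node) (v : List ℕ) :
    (intended root).ind (listName v) = .list v := by
  have h1 : (2 * Encodable.encode v + 1) % 2 = 1 := by omega
  have h2 : (2 * Encodable.encode v + 1) / 2 = Encodable.encode v := by omega
  simp [listName, h1, h2]

theorem num_mem_theNum (root : Node) (n : ℕ) : Node.num n ∈ (theNum n).ext (intended root) := by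
  induction n with
  | zero => exact ⟨(intended_ind_numName root 0).symm, mem_zero.2 fun ⟨_, h⟩ => h⟩
  | succ n ih =>
    exact ⟨(intended_ind_numName root (n + 1)).symm,
      mem_the.2 ⟨⟨.num n, rfl⟩, fun y hy => by obtain rfl : y = .num n := hy; exact ih⟩⟩

theorem list_mem_theList (root : Node) (v : List ℕ) :
    Node.list v ∈ (theList v).ext (intended root) := by
  have head (v : List ℕ) :
      Node.list v ∈ (the roleHead (theNum v.headI)).ext (intended root) :=
    mem_the.2 ⟨⟨.num v.headI, rfl⟩,
      fun y hy => by obtain rfl : y = .num v.headI := hy; exact num_mem_theNum root _⟩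
  induction v with
  | nil =>
    exact ⟨(intended_ind_listName root _).symm, head [], fun ⟨_, h, _⟩ => h⟩
  | cons n v ih =>
    exact ⟨(intended_ind_listName root _).symm, head (n :: v),
      mem_the.2 ⟨⟨.list v, rfl⟩, fun y hy => by obtain rfl : y = .list v := hy; exact ih⟩⟩

/-- The symbols available to separating concepts: the seven roles, and the individual names other
than the two in the database. -/
def separatorSig : Set Symbol := {s | (∃ r < 7, s = .role r) ∨ ∃ c, s = .ind (c + 2)}

theorem sig_the_subset {r : ℕ} {C : ALCOConcept} (hr : r < 7) (hC : C.sig ⊆ separatorSig) :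
    (the r C).sig ⊆ separatorSig := by
  have : Symbol.role r ∈ separatorSig := Or.inl ⟨r, hr, rfl⟩
  simp [the, all, sig, Set.insert_subset_iff, this, hC]

theorem sig_theNum_subset (n : ℕ) : (theNum n).sig ⊆ separatorSig := by
  have name (n : ℕ) : Symbol.ind (numName n) ∈ separatorSig := Or.inr ⟨2 * n, rfl⟩
  induction n with
  | zero =>
    have : Symbol.role rolePred ∈ separatorSig := Or.inl ⟨6, by omega, rfl⟩
    simp [theNum, sig, zero, Set.insert_subset_iff, name, this]
  | succ n ih =>
    simp [theNum, sig, Set.insert_subset_iff, name, sig_the_subset (r := 6) (by omega) ih]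

theorem sig_theList_subset (v : List ℕ) : (theList v).sig ⊆ separatorSig := by
  have name (v : List ℕ) : Symbol.ind (listName v) ∈ separatorSig :=
    Or.inr ⟨2 * Encodable.encode v + 1, rfl⟩
  have head (n : ℕ) := sig_the_subset (r := 4) (by omega) (sig_theNum_subset n)
  induction v with
  | nil =>
    have : Symbol.role roleTail ∈ separatorSig := Or.inl ⟨5, by omega, rfl⟩
    simp [theList, sig, Set.insert_subset_iff, name, this, head]
  | cons n v ih =>
    simp [theList, sig, Set.insert_subset_iff, name, head,
      sig_the_subset (r := 5) (by omega) ih]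

/-- The concept `C` holds at the run of `c` on `v` in the intended structure, and in every
structure that satisfies the inclusions for `c` its elements are non-defective runs of `c` from `v`
to `w`. -/
structure DescribesRun (c : Code) (v w : List ℕ) (C : ALCOConcept) : Prop where
  sig_subset : C.sig ⊆ separatorSig
  forces : ∀ M : Interp, (∀ α ∈ fixCIs c, M.SatCI α) → ∀ x ∈ C.ext M,
    x ∈ (the roleIn (theList v)).ext M ∧ x ∈ (the roleOut (theList w)).ext M ∧
      x ∉ (defect c).ext M
  mem_intended : ∀ root, Node.run c v ∈ C.ext (intended root)

/-- A description of a run is obtained from descriptions of its sub-runs: it suffices to add a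
description of the input and of the output. -/
theorem describesRun_of_and {c : Code} {v w : List ℕ} (hw : w ∈ c.eval v) {C : ALCOConcept}
    (hsig : C.sig ⊆ separatorSig)
    (hforces : ∀ M : Interp, (∀ α ∈ fixCIs c, M.SatCI α) → ∀ x ∈ C.ext M,
      x ∈ (the roleIn (theList v)).ext M → x ∈ (the roleOut (theList w)).ext M →
        x ∉ (defect c).ext M)
    (hmem : ∀ root, Node.run c v ∈ C.ext (intended root)) :
    DescribesRun c v w (and (and (the roleIn (theList v)) (the roleOut (theList w))) C) where
  sig_subset := by
    simp [sig, hsig, sig_the_subset (r := 0) (by omega) (sig_theList_subset v),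
      sig_the_subset (r := 1) (by omega) (sig_theList_subset w)]
  forces M hM x hx := ⟨hx.1.1, hx.1.2, hforces M hM x hx.2 hx.1.1 hx.1.2⟩
  mem_intended root := by
    refine ⟨⟨mem_the.2 ⟨⟨_, rfl⟩, ?_⟩, mem_the.2 ⟨⟨.list w, w, hw, rfl⟩, ?_⟩⟩, hmem root⟩
    · rintro _ rfl
      exact list_mem_theList root v
    · rintro _ ⟨w', hw', rfl⟩
      obtain rfl := Part.mem_unique hw hw'
      exact list_mem_theList root w

theorem mem_the_intended {root x y : Node} {r : ℕ} {C : ALCOConcept}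
    (hr : ∀ z, Node.role r x z ↔ z = y) (hy : y ∈ C.ext (intended root)) :
    x ∈ (the r C).ext (intended root) :=
  mem_the.2 ⟨⟨y, (hr y).2 rfl⟩, fun z hz => by obtain rfl := (hr z).1 hz; exact hy⟩

theorem exists_describesRun_zero' (v : List ℕ) :
    ∃ C, DescribesRun .zero' v (0 :: v) C := by
  refine ⟨_, describesRun_of_and (C := top) (mem_eval_zero'.2 rfl) (Set.empty_subset _)
    (fun M _ x _ hi ho hd => ?_) fun _ => trivial⟩
  simp only [mem_the] at hi ho
  obtain ⟨⟨y, hy⟩, hi⟩ := hi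
  obtain ⟨⟨z, hz⟩, ho⟩ := ho
  have hzl := isList_of_mem_theList (ho z hz)
  simp only [defect, mem_anyOf, List.mem_cons, List.not_mem_nil, or_false, exists_eq_or_imp,
    exists_eq_left, mem_differ, mem_neg, mem_ex, mem_and, mem_top, mem_atom, mem_zero,
    and_true] at hd
  rcases hd with hd | ⟨⟨z', hz', t, ht, hP⟩, y', hy', hP'⟩
  · exact hd ⟨z, hz, hzl.1, hzl.2.imp fun _ h => h.1⟩
  · exact hP' (eq_of_mem_theList (mem_theList_tail (ho z' hz') ht) (hi y' hy') ▸ hP)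

theorem exists_describesRun_succ (v : List ℕ) :
    ∃ C, DescribesRun .succ v [v.headI + 1] C := by
  refine ⟨_, describesRun_of_and (C := top) (mem_eval_succ.2 rfl) (Set.empty_subset _)
    (fun M _ x _ hi ho hd => ?_) fun _ => trivial⟩
  simp only [mem_the] at hi ho
  obtain ⟨⟨y, hy⟩, hi⟩ := hi
  obtain ⟨⟨z, hz⟩, ho⟩ := ho
  have hzl := isList_of_mem_theList (ho z hz)
  simp only [defect, mem_anyOf, List.mem_cons, List.not_mem_nil, or_false, exists_eq_or_imp,
    exists_eq_left, mem_differ, mem_neg, mem_ex, mem_and, mem_atom, mem_positive,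
    mem_emptyList] at hd
  rcases hd with hd | ⟨⟨z', hz', t, ht, s, hs, hP⟩, y', hy', t', ht', hP'⟩
  · exact hd ⟨z, hz, hzl.1.imp fun _ h => ⟨h.1, h.2.imp fun _ h => h.1⟩, hzl.2⟩
  · obtain ⟨m, hm, hs⟩ := mem_theNum_pred (mem_theList_head (ho z' hz') ht) hs
    obtain rfl : v.headI = m := Nat.succ.inj hm
    exact hP' (eq_of_mem_theNum hs (mem_theList_head (hi y' hy') ht') ▸ hP)

theorem exists_describesRun_tail (v : List ℕ) :
    ∃ C, DescribesRun .tail v v.tail C := by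
  refine ⟨_, describesRun_of_and (C := top) (mem_eval_tail.2 rfl) (Set.empty_subset _)
    (fun M _ x _ hi ho hd => ?_) fun _ => trivial⟩
  simp only [mem_the] at hi ho
  obtain ⟨⟨y, hy⟩, hi⟩ := hi
  obtain ⟨⟨z, hz⟩, ho⟩ := ho
  simp only [defect, mem_anyOf, List.mem_cons, List.not_mem_nil, or_false, exists_eq_or_imp,
    exists_eq_left, mem_differ, mem_neg, mem_ex, mem_top, mem_atom, mem_exTail, and_true] at hd
  rcases hd with hd | ⟨⟨z', hz', hP⟩, y', hy', t', ht', hP'⟩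
  · exact hd ⟨z, hz⟩
  · exact hP' (eq_of_mem_theList (ho z' hz') (mem_theList_isTail (hi y' hy') ht') ▸ hP)

theorem DescribesRun.cons {f g : Code} {v a b : List ℕ} {F G : ALCOConcept}
    (ha : a ∈ f.eval v) (hb : b ∈ g.eval v)
    (hF : DescribesRun f v a F) (hG : DescribesRun g v b G) :
    ∃ C, DescribesRun (f.cons g) v (a.headI :: b) C := by
  refine ⟨_, describesRun_of_and (C := and (the roleFst F) (the roleSnd G))
    (mem_eval_cons.2 ⟨a, ha, b, hb, rfl⟩)
    (Set.union_subset (sig_the_subset (r := 2) (by omega) hF.sig_subset)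
      (sig_the_subset (r := 3) (by omega) hG.sig_subset))
    (fun M hM x hx hi ho hd => ?_)
    fun root => ⟨mem_the_intended (fun _ => Iff.rfl) (hF.mem_intended root),
      mem_the_intended (fun _ => Iff.rfl) (hG.mem_intended root)⟩⟩
  have hF := hF.forces M fun α h => hM α (by simp [fixCIs, h])
  have hG := hG.forces M fun α h => hM α (by simp [fixCIs, h])
  simp only [mem_the, mem_and] at hi ho hx hF hG
  obtain ⟨⟨⟨x1, hx1⟩, h1⟩, ⟨x2, hx2⟩, h2⟩ := hx
  have hF1 := fun z hz => hF z (h1 z hz)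
  have hG2 := fun z hz => hG z (h2 z hz)
  obtain ⟨z, hz⟩ := ho.1
  have hzh := exists_head_of_mem_theList (ho.2 z hz)
  have hzt := exists_tail_of_mem_theList (ho.2 z hz)
  simp only [defect, mem_anyOf, List.mem_cons, List.not_mem_nil, or_false, exists_eq_or_imp,
    exists_eq_left, mem_differ, mem_neg, mem_ex, mem_top, mem_atom, mem_isCons, and_true] at hd
  rcases hd with hd | ⟨⟨z1, h1, t1, h1', hP⟩, t2, h2', hP'⟩ | ⟨z1, h1, hd⟩ | hd |
    ⟨⟨z1, h1, t1, h1', hP⟩, t2, h2', hP'⟩ | ⟨z1, h1, hd⟩ | hd |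
    ⟨⟨z1, h1, t1, h1', hP⟩, z2, h2, t2, h2', s2, h2'', hP'⟩ |
    ⟨⟨z1, h1, t1, h1', hP⟩, z2, h2, t2, h2', hP'⟩
  · exact hd ⟨x1, hx1, (hF1 x1 hx1).1.1⟩
  · exact hP' (eq_of_mem_theList ((hF1 z1 h1).1.2 t1 h1') (hi.2 t2 h2') ▸ hP)
  · exact (hF1 z1 h1).2.2 hd
  · exact hd ⟨x2, hx2, (hG2 x2 hx2).1.1⟩
  · exact hP' (eq_of_mem_theList ((hG2 z1 h1).1.2 t1 h1') (hi.2 t2 h2') ▸ hP)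
  · exact (hG2 z1 h1).2.2 hd
  · exact hd ⟨z, hz, hzh, hzt⟩
  · have ht1 : t1 ∈ (theNum a.headI).ext M :=
      mem_theList_head (v := a.headI :: b) (ho.2 z1 h1) h1'
    exact hP' (eq_of_mem_theNum ht1 (mem_theList_head ((hF1 z2 h2).2.1.2 t2 h2') h2'') ▸ hP)
  · exact hP' (eq_of_mem_theList (mem_theList_tail (ho.2 z1 h1) h1')
      ((hG2 z2 h2).2.1.2 t2 h2') ▸ hP)

theorem DescribesRun.comp {f g : Code} {v u w : List ℕ} {F G : ALCOConcept}
    (hu : u ∈ g.eval v) (hw : w ∈ f.eval u)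
    (hG : DescribesRun g v u G) (hF : DescribesRun f u w F) :
    ∃ C, DescribesRun (f.comp g) v w C := by
  refine ⟨_, describesRun_of_and (C := and (the roleFst G) (the roleSnd F))
    (mem_eval_comp.2 ⟨u, hu, hw⟩)
    (Set.union_subset (sig_the_subset (r := 2) (by omega) hG.sig_subset)
      (sig_the_subset (r := 3) (by omega) hF.sig_subset))
    (fun M hM x hx hi ho hd => ?_)
    fun root => ⟨mem_the_intended (fun _ => Iff.rfl) (hG.mem_intended root),
      mem_the_intended (fun z => ⟨?_, ?_⟩) (hF.mem_intended root)⟩⟩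
  · have hF := hF.forces M fun α h => hM α (by simp [fixCIs, h])
    have hG := hG.forces M fun α h => hM α (by simp [fixCIs, h])
    simp only [mem_the, mem_and] at hi ho hx hF hG
    obtain ⟨⟨⟨x1, hx1⟩, h1⟩, ⟨x2, hx2⟩, h2⟩ := hx
    have hG1 := fun z hz => hG z (h1 z hz)
    have hF2 := fun z hz => hF z (h2 z hz)
    simp only [defect, mem_anyOf, List.mem_cons, List.not_mem_nil, or_false, exists_eq_or_imp,
      exists_eq_left, mem_differ, mem_neg, mem_ex, mem_top, mem_atom, and_true] at hd
    rcases hd with hd | ⟨⟨z1, h1, t1, h1', hP⟩, t2, h2', hP'⟩ | ⟨z1, h1, hd⟩ | hd |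
      ⟨⟨z1, h1, t1, h1', hP⟩, z2, h2, t2, h2', hP'⟩ | ⟨z1, h1, hd⟩ | hd |
      ⟨⟨t1, h1', hP⟩, z2, h2, t2, h2', hP'⟩
    · exact hd ⟨x1, hx1, (hG1 x1 hx1).1.1⟩
    · exact hP' (eq_of_mem_theList ((hG1 z1 h1).1.2 t1 h1') (hi.2 t2 h2') ▸ hP)
    · exact (hG1 z1 h1).2.2 hd
    · exact hd ⟨x2, hx2, (hF2 x2 hx2).1.1⟩
    · exact hP' (eq_of_mem_theList ((hF2 z1 h1).1.2 t1 h1') ((hG1 z2 h2).2.1.2 t2 h2') ▸ hP)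
    · exact (hF2 z1 h1).2.2 hd
    · exact hd ho.1
    · exact hP' (eq_of_mem_theList (ho.2 t1 h1') ((hF2 z2 h2).2.1.2 t2 h2') ▸ hP)
  · rintro ⟨u', hu', rfl⟩
    rw [Part.mem_unique hu hu']
  · rintro rfl
    exact ⟨u, hu, rfl⟩

theorem DescribesRun.case_zero {f g : Code} {v w : List ℕ} {F : ALCOConcept}
    (h0 : v.headI = 0) (hw : w ∈ f.eval v.tail) (hF : DescribesRun f v.tail w F) :
    ∃ C, DescribesRun (f.case g) v w C := by
  refine ⟨_, describesRun_of_and (C := the roleFst F) (by rwa [eval_case_of_zero h0])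
    (sig_the_subset (r := 2) (by omega) hF.sig_subset)
    (fun M hM x hx hi ho hd => ?_)
    fun root => mem_the_intended (fun z => ⟨?_, ?_⟩) (hF.mem_intended root)⟩
  · have hF := hF.forces M fun α h => hM α (by simp [fixCIs, h])
    simp only [mem_the] at hi ho hx hF
    obtain ⟨⟨x1, hx1⟩, h1⟩ := hx
    have hF1 := fun z hz => hF z (h1 z hz)
    have not_positive : x ∉ (ex roleIn (ex roleHead positive)).ext M := by
      rintro ⟨y, hy, s, hs, t, ht, -⟩
      obtain ⟨m, hm, -⟩ := mem_theNum_pred (mem_theList_head (hi.2 y hy) hs) ht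
      omega
    simp only [defect, mem_anyOf, List.mem_cons, List.not_mem_nil, or_false, exists_eq_or_imp,
      exists_eq_left, mem_and, not_positive, false_and] at hd
    simp only [mem_differ, mem_neg, mem_ex, mem_top, mem_atom, mem_exTail, and_true] at hd
    rcases hd with hd | hd | ⟨⟨t1, h1', hP⟩, z2, h2, t2, h2', hP'⟩ |
      ⟨-, ⟨z1, h1, t1, h1', hP⟩, t2, h2', s2, h2'', hP'⟩ | ⟨-, z1, h1, hd⟩
    · exact hd ⟨x1, hx1, (hF1 x1 hx1).1.1⟩
    · exact hd ho.1
    · exact hP' (eq_of_mem_theList (ho.2 t1 h1') ((hF1 z2 h2).2.1.2 t2 h2') ▸ hP)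
    · exact hP' (eq_of_mem_theList ((hF1 z1 h1).1.2 t1 h1')
        (mem_theList_isTail (hi.2 t2 h2') h2'') ▸ hP)
    · exact (hF1 z1 h1).2.2 hd
  · rintro (⟨-, rfl⟩ | ⟨n, hn, -⟩)
    · rfl
    · omega
  · exact fun h => Or.inl ⟨h0, h⟩

theorem DescribesRun.case_succ {f g : Code} {v w : List ℕ} {n : ℕ} {G : ALCOConcept}
    (hn : v.headI = n + 1) (hw : w ∈ g.eval (n :: v.tail))
    (hG : DescribesRun g (n :: v.tail) w G) :
    ∃ C, DescribesRun (f.case g) v w C := by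
  refine ⟨_, describesRun_of_and (C := the roleFst G) (by rwa [eval_case_of_succ hn])
    (sig_the_subset (r := 2) (by omega) hG.sig_subset)
    (fun M hM x hx hi ho hd => ?_)
    fun root => mem_the_intended (fun z => ⟨?_, ?_⟩) (hG.mem_intended root)⟩
  · have hG := hG.forces M fun α h => hM α (by simp [fixCIs, h])
    simp only [mem_the] at hi ho hx hG
    obtain ⟨⟨x1, hx1⟩, h1⟩ := hx
    have hG1 := fun z hz => hG z (h1 z hz)
    have not_zero : x ∉ (ex roleIn (ex roleHead zero)).ext M := by
      rintro ⟨y, hy, s, hs, hs0⟩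
      have := isNum_of_mem_theNum (mem_theList_head (hi.2 y hy) hs)
      rw [hn] at this
      exact mem_zero.1 hs0 (this.imp fun _ h => h.1)
    obtain ⟨y1, hy1⟩ := (hG1 x1 hx1).1.1
    have hy1' := (hG1 x1 hx1).1.2 y1 hy1
    simp only [defect, mem_anyOf, List.mem_cons, List.not_mem_nil, or_false, exists_eq_or_imp,
      exists_eq_left, mem_and, not_zero, false_and, false_or] at hd
    simp only [mem_differ, mem_neg, mem_ex, mem_top, mem_atom, mem_exTail, mem_isCons,
      and_true] at hd
    rcases hd with hd | hd | ⟨⟨t1, h1', hP⟩, z2, h2, t2, h2', hP'⟩ | ⟨-, hd⟩ |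
      ⟨-, ⟨z1, h1, t1, h1', s1, h1'', hP⟩, t2, h2', s2, h2'', r2, h2''', hP'⟩ |
      ⟨-, ⟨z1, h1, t1, h1', s1, h1'', hP⟩, t2, h2', s2, h2'', hP'⟩ | ⟨-, z1, h1, hd⟩
    · exact hd ⟨x1, hx1, y1, hy1⟩
    · exact hd ho.1
    · exact hP' (eq_of_mem_theList (ho.2 t1 h1') ((hG1 z2 h2).2.1.2 t2 h2') ▸ hP)
    · exact hd ⟨x1, hx1, y1, hy1, exists_head_of_mem_theList hy1',
        exists_tail_of_mem_theList hy1'⟩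
    · obtain ⟨m, hm, hr⟩ := mem_theNum_pred (mem_theList_head (hi.2 t2 h2') h2'') h2'''
      obtain rfl : n = m := by omega
      exact hP' (eq_of_mem_theNum (mem_theList_head ((hG1 z1 h1).1.2 t1 h1') h1'') hr ▸ hP)
    · have hs1 : s1 ∈ (theList v.tail).ext M :=
        mem_theList_tail (v := n :: v.tail) ((hG1 z1 h1).1.2 t1 h1') h1''
      exact hP' (eq_of_mem_theList hs1 (mem_theList_isTail (hi.2 t2 h2') h2'') ▸ hP)
    · exact (hG1 z1 h1).2.2 hd
  · rintro (⟨h0, -⟩ | ⟨m, hm, rfl⟩)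
    · omega
    · obtain rfl : n = m := by omega
      rfl
  · exact fun h => Or.inr ⟨n, hn, h⟩

theorem DescribesRun.fix_stop {f : Code} {v u : List ℕ} {F : ALCOConcept}
    (hu : u ∈ f.eval v) (h0 : u.headI = 0) (hF : DescribesRun f v u F) :
    ∃ C, DescribesRun f.fix v u.tail C := by
  refine ⟨_, describesRun_of_and (C := the roleFst F) (mem_eval_fix.2 ⟨u, hu, Or.inl ⟨h0, rfl⟩⟩)
    (sig_the_subset (r := 2) (by omega) hF.sig_subset)
    (fun M hM x hx hi ho hd => ?_)
    fun root => mem_the_intended (fun _ => Iff.rfl) (hF.mem_intended root)⟩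
  have hF := hF.forces M fun α h => hM α (by simp [fixCIs, h])
  simp only [mem_the] at hi ho hx hF
  obtain ⟨⟨x1, hx1⟩, h1⟩ := hx
  have hF1 := fun z hz => hF z (h1 z hz)
  have not_positive : x ∉ (ex roleFst (ex roleOut (ex roleHead positive))).ext M := by
    rintro ⟨z, hz, y, hy, s, hs, t, ht, -⟩
    obtain ⟨m, hm, -⟩ := mem_theNum_pred (mem_theList_head ((hF1 z hz).2.1.2 y hy) hs) ht
    omega
  replace hd : x ∈ (fixDefect f).ext M := hM (fixCI f) (by simp [fixCIs]) hd
  simp only [fixDefect, mem_anyOf, List.mem_cons, List.not_mem_nil, or_false, exists_eq_or_imp,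
    exists_eq_left, mem_and, not_positive, false_and] at hd
  simp only [mem_differ, mem_neg, mem_ex, mem_top, mem_atom, mem_exTail, and_true] at hd
  rcases hd with hd | ⟨⟨z1, h1, t1, h1', hP⟩, t2, h2', hP'⟩ | ⟨z1, h1, hd⟩ | hd |
    ⟨-, ⟨t1, h1', hP⟩, z2, h2, t2, h2', s2, h2'', hP'⟩
  · exact hd ⟨x1, hx1, (hF1 x1 hx1).1.1⟩
  · exact hP' (eq_of_mem_theList ((hF1 z1 h1).1.2 t1 h1') (hi.2 t2 h2') ▸ hP)
  · exact (hF1 z1 h1).2.2 hd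
  · exact hd ho.1
  · exact hP' (eq_of_mem_theList (ho.2 t1 h1')
      (mem_theList_isTail ((hF1 z2 h2).2.1.2 t2 h2') h2'') ▸ hP)

theorem DescribesRun.fix_step {f : Code} {v u w : List ℕ} {F G : ALCOConcept}
    (hu : u ∈ f.eval v) (h0 : u.headI ≠ 0) (hw : w ∈ f.fix.eval u.tail)
    (hF : DescribesRun f v u F) (hG : DescribesRun f.fix u.tail w G) :
    ∃ C, DescribesRun f.fix v w C := by
  refine ⟨_, describesRun_of_and (C := and (the roleFst F) (the roleSnd G))
    (mem_eval_fix.2 ⟨u, hu, Or.inr ⟨h0, hw⟩⟩)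
    (Set.union_subset (sig_the_subset (r := 2) (by omega) hF.sig_subset)
      (sig_the_subset (r := 3) (by omega) hG.sig_subset))
    (fun M hM x hx hi ho hd => ?_)
    fun root => ⟨mem_the_intended (fun _ => Iff.rfl) (hF.mem_intended root),
      mem_the_intended (fun z => ⟨?_, ?_⟩) (hG.mem_intended root)⟩⟩
  · have hF := hF.forces M fun α h => hM α (by simp [fixCIs, h])
    have hG := hG.forces M hM
    simp only [mem_the, mem_and] at hi ho hx hF hG
    obtain ⟨⟨⟨x1, hx1⟩, h1⟩, ⟨x2, hx2⟩, h2⟩ := hx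
    have hF1 := fun z hz => hF z (h1 z hz)
    have hG2 := fun z hz => hG z (h2 z hz)
    have not_zero : x ∉ (ex roleFst (ex roleOut (ex roleHead zero))).ext M := by
      rintro ⟨z, hz, y, hy, s, hs, hs0⟩
      have := isNum_of_mem_theNum (mem_theList_head ((hF1 z hz).2.1.2 y hy) hs)
      obtain ⟨n, hn⟩ := Nat.exists_eq_succ_of_ne_zero h0
      rw [hn] at this
      exact mem_zero.1 hs0 (this.imp fun _ h => h.1)
    replace hd : x ∈ (fixDefect f).ext M := hM (fixCI f) (by simp [fixCIs]) hd
    simp only [fixDefect, mem_anyOf, List.mem_cons, List.not_mem_nil, or_false, exists_eq_or_imp,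
      exists_eq_left, mem_and, not_zero, false_and, false_or] at hd
    simp only [mem_differ, mem_neg, mem_ex, mem_top, mem_atom, mem_exTail, and_true] at hd
    rcases hd with hd | ⟨⟨z1, h1, t1, h1', hP⟩, t2, h2', hP'⟩ | ⟨z1, h1, hd⟩ | hd | ⟨-, hd⟩ |
      ⟨-, ⟨z1, h1, t1, h1', hP⟩, z2, h2, t2, h2', s2, h2'', hP'⟩ | ⟨-, z1, h1, hd⟩ |
      ⟨-, ⟨t1, h1', hP⟩, z2, h2, t2, h2', hP'⟩
    · exact hd ⟨x1, hx1, (hF1 x1 hx1).1.1⟩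
    · exact hP' (eq_of_mem_theList ((hF1 z1 h1).1.2 t1 h1') (hi.2 t2 h2') ▸ hP)
    · exact (hF1 z1 h1).2.2 hd
    · exact hd ho.1
    · exact hd ⟨x2, hx2, (hG2 x2 hx2).1.1⟩
    · exact hP' (eq_of_mem_theList ((hG2 z1 h1).1.2 t1 h1')
        (mem_theList_isTail ((hF1 z2 h2).2.1.2 t2 h2') h2'') ▸ hP)
    · exact (hG2 z1 h1).2.2 hd
    · exact hP' (eq_of_mem_theList (ho.2 t1 h1') ((hG2 z2 h2).2.1.2 t2 h2') ▸ hP)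
  · rintro ⟨u', hu', -, rfl⟩
    rw [Part.mem_unique hu hu']
  · rintro rfl
    exact ⟨u, hu, h0, rfl⟩

theorem exists_describesRun {c : Code} {v w : List ℕ} (hw : w ∈ c.eval v) :
    ∃ C, DescribesRun c v w C := by
  induction c generalizing v w with
  | zero' =>
    obtain rfl := mem_eval_zero'.1 hw
    exact exists_describesRun_zero' v
  | succ =>
    obtain rfl := mem_eval_succ.1 hw
    exact exists_describesRun_succ v
  | tail =>
    obtain rfl := mem_eval_tail.1 hw
    exact exists_describesRun_tail v
  | cons f g ihf ihg =>
    obtain ⟨a, ha, b, hb, rfl⟩ := mem_eval_cons.1 hw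
    obtain ⟨F, hF⟩ := ihf ha
    obtain ⟨G, hG⟩ := ihg hb
    exact hF.cons ha hb hG
  | comp f g ihf ihg =>
    obtain ⟨u, hu, hw⟩ := mem_eval_comp.1 hw
    obtain ⟨G, hG⟩ := ihg hu
    obtain ⟨F, hF⟩ := ihf hw
    exact hG.comp hu hw hF
  | case f g ihf ihg =>
    cases hn : v.headI with
    | zero =>
      rw [eval_case_of_zero hn] at hw
      obtain ⟨F, hF⟩ := ihf hw
      exact hF.case_zero hn hw
    | succ n =>
      rw [eval_case_of_succ hn] at hw
      obtain ⟨G, hG⟩ := ihg hw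
      exact hG.case_succ hn hw
  | fix f ih =>
    have hfix := hw
    rw [Code.fix_eval] at hfix
    revert hw
    refine PFun.fixInduction (C := fun v => w ∈ f.fix.eval v → ∃ C, DescribesRun f.fix v w C)
      hfix fun v _ ihv hw => ?_
    obtain ⟨u, hu, ⟨h0, rfl⟩ | ⟨h0, hw⟩⟩ := mem_eval_fix.1 hw
    · obtain ⟨F, hF⟩ := ih hu
      exact hF.fix_stop hu h0
    · obtain ⟨F, hF⟩ := ih hu
      obtain ⟨G, hG⟩ := ihv u.tail ((Part.mem_map_iff _).2 ⟨u, hu, if_neg h0⟩) hw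
      exact hF.fix_step hu h0 hw hG

/-! ### Structures without defect contain computations -/

/-- The extension of `C` depends monotonically on the interpretation of the concept names other
than `testName`. -/
def IsMono (C : ALCOConcept) : Prop :=
  ∀ (M : Interp) (V W : ℕ → Set M.dom), V testName = W testName → (∀ A, V A ⊆ W A) →
    C.ext (M.withConcepts V) ⊆ C.ext (M.withConcepts W)

theorem IsMono.ex {C : ALCOConcept} (h : IsMono C) (r : ℕ) : IsMono (ex r C) := by
  rintro M V W h2 hVW x ⟨y, hy, hC⟩
  exact ⟨y, hy, h M V W h2 hVW hC⟩

theorem IsMono.and {C D : ALCOConcept} (hC : IsMono C) (hD : IsMono D) : IsMono (and C D) :=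
  fun M V W h2 hVW _ hx => ⟨hC M V W h2 hVW hx.1, hD M V W h2 hVW hx.2⟩

theorem IsMono.anyOf {l : List ALCOConcept} (h : ∀ C ∈ l, IsMono C) : IsMono (anyOf l) := by
  intro M V W h2 hVW x hx
  obtain ⟨C, hC, hx⟩ := mem_anyOf.1 hx
  exact mem_anyOf.2 ⟨C, hC, h C hC M V W h2 hVW hx⟩

/-- A concept without concept names other than `testName` is monotone for trivial reasons. -/
theorem isMono_of_sig {C : ALCOConcept} (h : ∀ A, Symbol.concept A ∈ C.sig → A = testName) :
    IsMono C := by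
  intro M V W h2 _
  have := ext_congr (M := M.withConcepts W) (concept' := V) (ind' := M.ind) (C := C)
    (fun A hA => by rw [h A hA]; exact h2) fun _ _ => rfl
  exact this.le

theorem isMono_defect (c : Code) : IsMono (defect c) := by
  induction c with
  | fix f =>
    intro M V W _ hVW
    exact hVW _
  | _ =>
    refine IsMono.anyOf ?_
    simp only [List.forall_mem_cons, List.not_mem_nil, false_imp_iff, implies_true, and_true]
    repeat' apply And.intro
    all_goals first
      | exact IsMono.ex ‹_› _
      | exact (isMono_of_sig (by simp [sig, zero, positive])).and (IsMono.ex ‹_› _)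
      | exact isMono_of_sig (by
          simp [sig, differ, exTail, ALCOConcept.anyOf, zero, positive, emptyList, isCons])

theorem isMono_fixDefect (f : Code) : IsMono (fixDefect f) := by
  have h1 := isMono_defect f
  have h2 := isMono_defect f.fix
  refine IsMono.anyOf ?_
  simp only [List.forall_mem_cons, List.not_mem_nil, false_imp_iff, implies_true, and_true]
  repeat' apply And.intro
  all_goals first
    | exact IsMono.ex ‹_› _
    | exact (isMono_of_sig (by simp [sig, positive])).and (IsMono.ex ‹_› _)
    | exact isMono_of_sig (by
        simp [sig, differ, exTail, ALCOConcept.anyOf, zero, positive])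

section Structure

variable {M : Interp}

/-- An interpretation of the concept names that satisfies the inclusions for all codes `fix f`. -/
def IsValid (M : Interp) (V : ℕ → Set M.dom) : Prop :=
  ∀ f, (M.withConcepts V).SatCI (fixCI f)

/-- The concept names can be interpreted in such a way that `x` is a defective run of `c`. -/
def Defective (M : Interp) (c : Code) (x : M.dom) : Prop :=
  ∃ V, IsValid M V ∧ x ∈ (defect c).ext (M.withConcepts V)

/-- If `x` has an input that represents a list, then the code evaluates on this list to some value,
and an output of `x` represents the value. -/
def Sound (M : Interp) (c : Code) (x : M.dom) : Prop :=
  ∀ v y, M.role roleIn x y → IsList M.role v y →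
    ∃ w ∈ c.eval v, ∃ z, M.role roleOut x z ∧ IsList M.role w z

/-- The interpretation of `testName` by `P` and of all other concept names by the empty set, so that
no run of any `fix f` is marked as defective. -/
def testOnly {α : Type} (P : Set α) : ℕ → Set α := fun A => if A = testName then P else ∅

theorem isValid_testOnly (P : Set M.dom) : IsValid M (testOnly P) := by
  intro f y hy
  have : defectName f ≠ testName := by simp [defectName, testName]
  simp [fixCI, testOnly, this] at hy

/-- Since the concept name for defective runs of `fix f` occurs only positively in `fixDefect f`,
its interpretation can be extended by any element that satisfies `fixDefect f`. -/
theorem Defective.of_mem_fixDefect {f : Code} {x : M.dom} {V : ℕ → Set M.dom} (hV : IsValid M V)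
    (hx : x ∈ (fixDefect f).ext (M.withConcepts V)) : Defective M f.fix x := by
  let W : ℕ → Set M.dom := fun A => if A = defectName f then insert x (V A) else V A
  have hVW : ∀ A, V A ⊆ W A := by
    intro A
    by_cases h : A = defectName f <;> simp [W, h]
  have h2 : V testName = W testName := by
    have : testName ≠ defectName f := by simp [defectName, testName]
    simp [W, this]
  refine ⟨W, fun g y hy => ?_, show x ∈ W _ by simp [W]⟩
  have mono := isMono_fixDefect g M V W h2 hVW
  change y ∈ W (defectName g) at hy
  by_cases h : g = f
  · simp only [W, h, if_true, Set.mem_insert_iff] at hy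
    rcases hy with hy | hy
    · rw [hy]
      exact mono (h ▸ hx)
    · exact mono (h ▸ hV f hy)
  · have hne : defectName g ≠ defectName f := by
      simp only [defectName, ne_eq, Nat.add_right_cancel_iff]
      exact fun e => h (Code.fix.inj (codeIdx_injective e))
    simp only [W, if_neg hne] at hy
    exact mono (hV g hy)

/-- The run `x` of `fix f` has a first sub-run whose output calls for another iteration, and `y` is
a second sub-run of `x`. -/
def IsNextIteration (M : Interp) (y x : M.dom) : Prop :=
  (∃ z, M.role roleFst x z ∧ ∃ u, M.role roleOut z u ∧
    ∃ a, M.role roleHead u a ∧ ∃ p, M.role rolePred a p) ∧ M.role roleSnd x y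

/-- An infinite chain of iterations counts as a defect of runs of `fix f`, because the name for
defective runs may be interpreted as the set of all elements where such a chain starts. -/
theorem acc_of_not_defective {f : Code} {x : M.dom} (h : ¬ Defective M f.fix x) :
    Acc (IsNextIteration M) x := by
  by_contra hx
  let V : ℕ → Set M.dom :=
    fun A => if A = defectName f then {z | ¬ Acc (IsNextIteration M) z} else ∅
  have hV : V (defectName f) = {z | ¬ Acc (IsNextIteration M) z} := if_pos rfl
  refine h ⟨V, fun g z hz => ?_, show x ∈ V (defectName f) from hV ▸ hx⟩
  change z ∈ V (defectName g) at hz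
  by_cases hg : defectName g = defectName f
  · rw [hg, hV] at hz
    obtain ⟨y, hy, hy'⟩ : ∃ y, IsNextIteration M y z ∧ ¬ Acc (IsNextIteration M) y := by
      by_contra! hacc
      exact hz ⟨z, hacc⟩
    refine mem_anyOf.2 ⟨and (ex roleFst (ex roleOut (ex roleHead positive)))
      (ex roleSnd (defect g.fix)), by simp, ?_, y, hy.2, ?_⟩
    · simpa using hy.1
    · change y ∈ V (defectName g)
      rwa [hg, hV]
  · simp [V, hg] at hz

/-- If no interpretation of `testName` separates two elements, they are equal. This turns the
absence of inequality defects into equalities. -/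
theorem eq_of_forall_isValid {y z : M.dom}
    (h : ∀ V, IsValid M V → ¬ (y ∈ V testName ∧ z ∉ V testName)) : y = z :=
  by_contra fun hne => h _ (isValid_testOnly {y}) ⟨rfl, fun e => hne e.symm⟩

theorem sound_zero' {x : M.dom}
    (h : ∀ V, IsValid M V → x ∉ (defect .zero').ext (M.withConcepts V)) :
    Sound M .zero' x := by
  intro v y hy hv
  simp only [defect, mem_anyOf, List.mem_cons, List.not_mem_nil,
    or_false, exists_eq_or_imp, exists_eq_left, mem_differ, mem_neg, mem_ex, mem_and, mem_top,
    mem_atom, mem_zero, and_true, not_or, forall_and, not_not] at h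
  obtain ⟨h1, h2⟩ := h
  obtain ⟨z, hz, ⟨a, ha, ha'⟩, t, ht⟩ := h1 _ (isValid_testOnly ∅)
  obtain rfl : t = y := eq_of_forall_isValid fun V hV e =>
    h2 V hV ⟨⟨z, hz, t, ht, e.1⟩, y, hy, e.2⟩
  exact ⟨_, mem_eval_zero'.2 rfl, z, hz, ⟨a, ha, ha'⟩, t, ht, hv⟩

theorem sound_succ {x : M.dom}
    (h : ∀ V, IsValid M V → x ∉ (defect .succ).ext (M.withConcepts V)) :
    Sound M .succ x := by
  intro v y hy hv
  simp only [defect, mem_anyOf, List.mem_cons, List.not_mem_nil,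
    or_false, exists_eq_or_imp, exists_eq_left, mem_differ, mem_neg, mem_ex, mem_and,
    mem_atom, mem_positive, mem_emptyList, not_or, forall_and, not_not] at h
  obtain ⟨h1, h2⟩ := h
  obtain ⟨z, hz, ⟨a, ha, p, hp⟩, t, ht⟩ := h1 _ (isValid_testOnly ∅)
  obtain ⟨b, hb, hb'⟩ := hv.head
  obtain rfl : p = b := eq_of_forall_isValid fun V hV e =>
    h2 V hV ⟨⟨z, hz, a, ha, p, hp, e.1⟩, y, hy, b, hb, e.2⟩
  exact ⟨_, mem_eval_succ.2 rfl, z, hz, ⟨a, ha, p, hp, hb'⟩, t, ht⟩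

theorem sound_tail {x : M.dom}
    (h : ∀ V, IsValid M V → x ∉ (defect .tail).ext (M.withConcepts V)) :
    Sound M .tail x := by
  intro v y hy hv
  simp only [defect, mem_anyOf, List.mem_cons, List.not_mem_nil,
    or_false, exists_eq_or_imp, exists_eq_left, mem_differ, mem_neg, mem_ex, mem_top, mem_exTail,
    mem_atom, and_true, not_or, forall_and, not_not] at h
  obtain ⟨h1, h2⟩ := h
  obtain ⟨z, hz⟩ := h1 _ (isValid_testOnly ∅)
  obtain ⟨b, hb, hb'⟩ := hv.tail
  obtain rfl : z = b := eq_of_forall_isValid fun V hV e =>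
    h2 V hV ⟨⟨z, hz, e.1⟩, y, hy, b, hb, e.2⟩
  exact ⟨_, mem_eval_tail.2 rfl, z, hz, hb'⟩

theorem sound_cons {f g : Code} {x : M.dom}
    (ihf : ∀ x : M.dom, ¬ Defective M f x → Sound M f x)
    (ihg : ∀ x : M.dom, ¬ Defective M g x → Sound M g x)
    (h : ∀ V, IsValid M V → x ∉ (defect (f.cons g)).ext (M.withConcepts V)) :
    Sound M (f.cons g) x := by
  intro v y hy hv
  simp only [defect, mem_anyOf, List.mem_cons, List.not_mem_nil,
    or_false, exists_eq_or_imp, exists_eq_left, mem_differ, mem_neg, mem_ex, mem_top, mem_isCons,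
    mem_atom, and_true, not_or, forall_and, not_not] at h
  obtain ⟨h1, h2, h3, h4, h5, h6, h7, h8, h9⟩ := h
  obtain ⟨x1, hx1, y1, hy1⟩ := h1 _ (isValid_testOnly ∅)
  obtain rfl : y1 = y := eq_of_forall_isValid fun V hV e =>
    h2 V hV ⟨⟨x1, hx1, y1, hy1, e.1⟩, y, hy, e.2⟩
  obtain ⟨a, ha, z1, hz1, ha'⟩ :=
    ihf x1 (fun ⟨V, hV, hd⟩ => h3 V hV ⟨x1, hx1, hd⟩) v y1 hy1 hv
  obtain ⟨x2, hx2, y2, hy2⟩ := h4 _ (isValid_testOnly ∅)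
  obtain rfl : y2 = y1 := eq_of_forall_isValid fun V hV e =>
    h5 V hV ⟨⟨x2, hx2, y2, hy2, e.1⟩, y1, hy, e.2⟩
  obtain ⟨b, hb, z2, hz2, hb'⟩ :=
    ihg x2 (fun ⟨V, hV, hd⟩ => h6 V hV ⟨x2, hx2, hd⟩) v y2 hy2 hv
  obtain ⟨z, hz, ⟨s, hs⟩, t, ht⟩ := h7 _ (isValid_testOnly ∅)
  obtain ⟨s', hs', hs''⟩ := ha'.head
  obtain rfl : s = s' := eq_of_forall_isValid fun V hV e =>
    h8 V hV ⟨⟨z, hz, s, hs, e.1⟩, x1, hx1, z1, hz1, s', hs', e.2⟩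
  obtain rfl : t = z2 := eq_of_forall_isValid fun V hV e =>
    h9 V hV ⟨⟨z, hz, t, ht, e.1⟩, x2, hx2, z2, hz2, e.2⟩
  exact ⟨_, mem_eval_cons.2 ⟨a, ha, b, hb, rfl⟩, z, hz, ⟨s, hs, hs''⟩, t, ht, hb'⟩

theorem sound_comp {f g : Code} {x : M.dom}
    (ihf : ∀ x : M.dom, ¬ Defective M f x → Sound M f x)
    (ihg : ∀ x : M.dom, ¬ Defective M g x → Sound M g x)
    (h : ∀ V, IsValid M V → x ∉ (defect (f.comp g)).ext (M.withConcepts V)) :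
    Sound M (f.comp g) x := by
  intro v y hy hv
  simp only [defect, mem_anyOf, List.mem_cons, List.not_mem_nil,
    or_false, exists_eq_or_imp, exists_eq_left, mem_differ, mem_neg, mem_ex, mem_top,
    mem_atom, and_true, not_or, forall_and, not_not] at h
  obtain ⟨h1, h2, h3, h4, h5, h6, h7, h8⟩ := h
  obtain ⟨x1, hx1, y1, hy1⟩ := h1 _ (isValid_testOnly ∅)
  obtain rfl : y1 = y := eq_of_forall_isValid fun V hV e =>
    h2 V hV ⟨⟨x1, hx1, y1, hy1, e.1⟩, y, hy, e.2⟩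
  obtain ⟨u, hu, z1, hz1, hu'⟩ :=
    ihg x1 (fun ⟨V, hV, hd⟩ => h3 V hV ⟨x1, hx1, hd⟩) v y1 hy1 hv
  obtain ⟨x2, hx2, y2, hy2⟩ := h4 _ (isValid_testOnly ∅)
  obtain rfl : y2 = z1 := eq_of_forall_isValid fun V hV e =>
    h5 V hV ⟨⟨x2, hx2, y2, hy2, e.1⟩, x1, hx1, z1, hz1, e.2⟩
  obtain ⟨w, hw, z2, hz2, hw'⟩ :=
    ihf x2 (fun ⟨V, hV, hd⟩ => h6 V hV ⟨x2, hx2, hd⟩) u y2 hy2 hu'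
  obtain ⟨z, hz⟩ := h7 _ (isValid_testOnly ∅)
  obtain rfl : z = z2 := eq_of_forall_isValid fun V hV e =>
    h8 V hV ⟨⟨z, hz, e.1⟩, x2, hx2, z2, hz2, e.2⟩
  exact ⟨_, mem_eval_comp.2 ⟨u, hu, hw⟩, z, hz, hw'⟩

theorem sound_case {f g : Code} {x : M.dom}
    (ihf : ∀ x : M.dom, ¬ Defective M f x → Sound M f x)
    (ihg : ∀ x : M.dom, ¬ Defective M g x → Sound M g x)
    (h : ∀ V, IsValid M V → x ∉ (defect (f.case g)).ext (M.withConcepts V)) :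
    Sound M (f.case g) x := by
  intro v y hy hv
  simp only [defect, mem_anyOf, List.mem_cons, List.not_mem_nil,
    or_false, exists_eq_or_imp, exists_eq_left, mem_differ, mem_neg, mem_ex, mem_and, mem_top,
    mem_exTail, mem_zero, mem_positive, mem_isCons,
    mem_atom, and_true, not_or, forall_and] at h
  obtain ⟨h1, h2, h3, h4, h5, h6, h7, h8, h9⟩ := h
  obtain ⟨x1, hx1, y1, hy1⟩ := not_not.1 (h1 _ (isValid_testOnly ∅))
  obtain ⟨z, hz⟩ := not_not.1 (h2 _ (isValid_testOnly ∅))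
  obtain ⟨a, ha, ha'⟩ := hv.head
  obtain ⟨b, hb, hb'⟩ := hv.tail
  cases hn : v.headI with
  | zero =>
    rw [hn] at ha'
    obtain rfl : y1 = b := eq_of_forall_isValid fun V hV e =>
      h4 V hV ⟨⟨y, hy, a, ha, ha'⟩, ⟨x1, hx1, y1, hy1, e.1⟩, y, hy, b, hb, e.2⟩
    obtain ⟨w, hw, z1, hz1, hw'⟩ :=
      ihf x1 (fun ⟨V, hV, hd⟩ => h5 V hV ⟨⟨y, hy, a, ha, ha'⟩, x1, hx1, hd⟩) _ y1 hy1 hb'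
    obtain rfl : z = z1 := eq_of_forall_isValid fun V hV e =>
      h3 V hV ⟨⟨z, hz, e.1⟩, x1, hx1, z1, hz1, e.2⟩
    exact ⟨w, by rwa [eval_case_of_zero hn], z, hz, hw'⟩
  | succ n =>
    rw [hn] at ha'
    obtain ⟨p, hp, hp'⟩ := ha'
    have hpos : ∃ y, M.role roleIn x y ∧ ∃ z, M.role roleHead y z ∧ ∃ t, M.role rolePred z t :=
      ⟨y, hy, a, ha, p, hp⟩
    obtain ⟨x1, hx1, y1, hy1, ⟨s, hs⟩, t, ht⟩ :=
      not_not.1 fun h => h6 _ (isValid_testOnly ∅) ⟨hpos, h⟩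
    obtain rfl : s = p := eq_of_forall_isValid fun V hV e =>
      h7 V hV ⟨hpos, ⟨x1, hx1, y1, hy1, s, hs, e.1⟩, y, hy, a, ha, p, hp, e.2⟩
    obtain rfl : t = b := eq_of_forall_isValid fun V hV e =>
      h8 V hV ⟨hpos, ⟨x1, hx1, y1, hy1, t, ht, e.1⟩, y, hy, b, hb, e.2⟩
    obtain ⟨w, hw, z1, hz1, hw'⟩ :=
      ihg x1 (fun ⟨V, hV, hd⟩ => h9 V hV ⟨hpos, x1, hx1, hd⟩) (n :: v.tail) y1 hy1
        ⟨⟨s, hs, hp'⟩, t, ht, hb'⟩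
    obtain rfl : z = z1 := eq_of_forall_isValid fun V hV e =>
      h3 V hV ⟨⟨z, hz, e.1⟩, x1, hx1, z1, hz1, e.2⟩
    exact ⟨w, by rwa [eval_case_of_succ hn], z, hz, hw'⟩

theorem sound_fix {f : Code} {x : M.dom}
    (ih : ∀ x : M.dom, ¬ Defective M f x → Sound M f x) (hx : ¬ Defective M f.fix x) :
    Sound M f.fix x := by
  induction acc_of_not_defective hx with
  | intro x _ ihx =>
      intro v y hy hv
      have h : ∀ V, IsValid M V → x ∉ (fixDefect f).ext (M.withConcepts V) :=
        fun V hV hd => hx (.of_mem_fixDefect hV hd)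
      simp only [fixDefect, mem_anyOf, List.mem_cons, List.not_mem_nil,
        or_false, exists_eq_or_imp, exists_eq_left, mem_differ, mem_neg, mem_ex, mem_and, mem_top,
        mem_exTail, mem_zero, mem_positive,
        mem_atom, and_true, not_or, forall_and] at h
      obtain ⟨h1, h2, h3, h4, h5, h6, h7, h8, h9⟩ := h
      obtain ⟨x1, hx1, y1, hy1⟩ := not_not.1 (h1 _ (isValid_testOnly ∅))
      obtain rfl : y1 = y := eq_of_forall_isValid fun V hV e =>
        h2 V hV ⟨⟨x1, hx1, y1, hy1, e.1⟩, y, hy, e.2⟩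
      obtain ⟨u, hu, z1, hz1, hu'⟩ :=
        ih x1 (fun ⟨V, hV, hd⟩ => h3 V hV ⟨x1, hx1, hd⟩) v y1 hy1 hv
      obtain ⟨z, hz⟩ := not_not.1 (h4 _ (isValid_testOnly ∅))
      obtain ⟨a, ha, ha'⟩ := hu'.head
      obtain ⟨b, hb, hb'⟩ := hu'.tail
      cases hn : u.headI with
      | zero =>
        rw [hn] at ha'
        obtain rfl : z = b := eq_of_forall_isValid fun V hV e =>
          h5 V hV ⟨⟨x1, hx1, z1, hz1, a, ha, ha'⟩, ⟨z, hz, e.1⟩, x1, hx1, z1, hz1, b, hb, e.2⟩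
        exact ⟨_, mem_eval_fix.2 ⟨u, hu, Or.inl ⟨hn, rfl⟩⟩, z, hz, hb'⟩
      | succ n =>
        rw [hn] at ha'
        obtain ⟨p, hp, -⟩ := ha'
        have hpos : ∃ x1, M.role roleFst x x1 ∧ ∃ y, M.role roleOut x1 y ∧
            ∃ z, M.role roleHead y z ∧ ∃ t, M.role rolePred z t :=
          ⟨x1, hx1, z1, hz1, a, ha, p, hp⟩
        obtain ⟨x2, hx2, y2, hy2⟩ :=
          not_not.1 fun h => h6 _ (isValid_testOnly ∅) ⟨hpos, h⟩
        obtain rfl : y2 = b := eq_of_forall_isValid fun V hV e =>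
          h7 V hV ⟨hpos, ⟨x2, hx2, y2, hy2, e.1⟩, x1, hx1, z1, hz1, b, hb, e.2⟩
        obtain ⟨w, hw, z2, hz2, hw'⟩ :=
          ihx x2 ⟨hpos, hx2⟩ (fun ⟨V, hV, hd⟩ => h8 V hV ⟨hpos, x2, hx2, hd⟩) _ y2 hy2 hb'
        obtain rfl : z = z2 := eq_of_forall_isValid fun V hV e =>
          h9 V hV ⟨hpos, ⟨z, hz, e.1⟩, x2, hx2, z2, hz2, e.2⟩
        exact ⟨w, mem_eval_fix.2 ⟨u, hu, Or.inr ⟨by omega, hw⟩⟩, z, hz, hw'⟩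

theorem sound_of_not_defective {c : Code} {x : M.dom} (hx : ¬ Defective M c x) :
    Sound M c x := by
  have h : ∀ V, IsValid M V → x ∉ (defect c).ext (M.withConcepts V) :=
    fun V hV hd => hx ⟨V, hV, hd⟩
  induction c generalizing x with
  | zero' => exact sound_zero' h
  | succ => exact sound_succ h
  | tail => exact sound_tail h
  | cons f g ihf ihg =>
    exact sound_cons (fun x hx => ihf hx fun V hV hd => hx ⟨V, hV, hd⟩)
      (fun x hx => ihg hx fun V hV hd => hx ⟨V, hV, hd⟩) h
  | comp f g ihf ihg =>
    exact sound_comp (fun x hx => ihf hx fun V hV hd => hx ⟨V, hV, hd⟩)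
      (fun x hx => ihg hx fun V hV hd => hx ⟨V, hV, hd⟩) h
  | case f g ihf ihg =>
    exact sound_case (fun x hx => ihf hx fun V hV hd => hx ⟨V, hV, hd⟩)
      (fun x hx => ihg hx fun V hV hd => hx ⟨V, hV, hd⟩) h
  | fix f ih => exact sound_fix (fun x hx => ih hx fun V hV hd => hx ⟨V, hV, hd⟩) hx

end Structure

/-! ### The reduction -/

/-- The concept "the input is the list `[n]`". -/
def inputIs (n : ℕ) : ALCOConcept :=
  ex roleIn (and (ex roleHead (num n)) (ex roleTail emptyList))

/-- The inclusion that requires the positive example to be a defective run of `c` if its input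
is `[n]`. -/
def startCI (c : Code) (n : ℕ) : CI := ⟨and (atom 0) (inputIs n), defect c⟩

/-- The roles that may be used by separating concepts. -/
def sgnRoles : List ℕ := List.range 7

/-- The instance of the separability problem for the computation of `c` on input `[n]`. The
individual name `0` is the positive example and `1` the negative example. The concept name `0`
marks the positive example; the concept name `1` only makes the negative example occur in the
database, and the inclusions `∃ r. ⊤ ⊑ ⊤` only make the roles occur in the knowledge base. -/
def reduction (c : Code) (n : ℕ) : Input where
  K :=
    { ontology := startCI c n :: (sgnRoles.map (fun r => ⟨ex r top, top⟩) ++ fixCIs c)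
      database := [.concept 0 0, .concept 1 1] }
  pos := [0]
  neg := [1]
  sgn := sgnRoles.map .role

theorem reduction_isALC (c : Code) (n : ℕ) : (reduction c n).K.IsALC := by
  have hnum : (num n).IsALC := by
    induction n with
    | zero => trivial
    | succ n ih => exact ih
  intro α hα
  simp only [reduction, List.mem_cons, List.mem_append, List.mem_map] at hα
  rcases hα with rfl | ⟨r, -, rfl⟩ | hα
  · exact ⟨⟨trivial, hnum, trivial, trivial⟩, isALC_defect c⟩
  · exact ⟨trivial, trivial⟩
  · obtain ⟨f, rfl⟩ := exists_eq_fixCI_of_mem_fixCIs hα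
    exact ⟨trivial, isALC_fixDefect f⟩

theorem reduction_valid (c : Code) (n : ℕ) : (reduction c n).Valid where
  isALC := reduction_isALC c n
  pos_nonempty := by simp [reduction]
  neg_nonempty := by simp [reduction]
  pos_subset a ha := ⟨.concept 0 0, by simp [reduction], by simpa [reduction, Fact.inds] using ha⟩
  neg_subset a ha := ⟨.concept 1 1, by simp [reduction], by simpa [reduction, Fact.inds] using ha⟩
  sgn_subset s hs := by
    obtain ⟨r, hr, rfl⟩ := List.mem_map.1 hs
    exact Or.inl ⟨⟨ex r top, top⟩, by simp [reduction, hr], by simp [CI.sig, sig]⟩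

theorem ind_mem_sig_reduction {c : Code} {n a : ℕ} :
    Symbol.ind a ∈ (reduction c n).K.sig ↔ a = 0 ∨ a = 1 := by
  constructor
  · rintro (⟨α, hα, h⟩ | ⟨f, hf, h⟩)
    · have hALC := reduction_isALC c n α hα
      exact (h.elim (ind_notMem_sig_of_isALC hALC.1) (ind_notMem_sig_of_isALC hALC.2)).elim
    · simp only [reduction, List.mem_cons, List.not_mem_nil, or_false] at hf
      rcases hf with rfl | rfl <;> simp_all [Fact.sig]
  · rintro (rfl | rfl)
    · exact Or.inr ⟨.concept 0 0, by simp [reduction], by simp [Fact.sig]⟩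
    · exact Or.inr ⟨.concept 1 1, by simp [reduction], by simp [Fact.sig]⟩

theorem intended_isModel (c : Code) (n : ℕ) (root : Node) :
    (intended root).IsModel (reduction c n).K := by
  refine ⟨fun α hα => ?_, fun f hf => ?_⟩
  · simp only [reduction, List.mem_cons, List.mem_append, List.mem_map] at hα
    rcases hα with rfl | ⟨r, -, rfl⟩ | hα
    · rintro x ⟨hx, y, hy, -⟩
      obtain rfl : x = .num 0 := hx
      exact hy.elim
    · exact fun _ _ => trivial
    · obtain ⟨f, rfl⟩ := exists_eq_fixCI_of_mem_fixCIs hα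
      exact fun x hx => hx.elim
  · simp only [reduction, List.mem_cons, List.not_mem_nil, or_false] at hf
    rcases hf with rfl | rfl
    · exact rfl
    · trivial

theorem mem_inputIs {M : Interp} {x : M.dom} {n : ℕ} :
    x ∈ (inputIs n).ext M ↔ ∃ y, M.role roleIn x y ∧ IsList M.role [n] y := by
  simp only [inputIs, mem_ex, mem_and, mem_num, mem_emptyList, IsList]

/-- If `c` halts on `[n]`, the complement of a description of its run separates. -/
theorem separable_of_mem_eval {c : Code} {n : ℕ} {w : List ℕ} (hw : w ∈ c.eval [n]) :
    (reduction c n).SeparableWithIndHelpers := by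
  obtain ⟨C, hC⟩ := exists_describesRun hw
  refine ⟨{s | ∃ a, s = .ind (a + 2)}, ?_, ?_, neg C, ?_, ?_, ?_⟩
  · rintro _ ⟨a, rfl⟩
    exact Or.inr ⟨_, rfl⟩
  · rw [Set.disjoint_left]
    rintro _ ⟨a, rfl⟩ h
    have := ind_mem_sig_reduction.1 h
    omega
  · intro s hs
    rcases hC.sig_subset hs with ⟨r, hr, rfl⟩ | ⟨a, rfl⟩
    · exact Or.inl (by simpa [reduction, sgnRoles] using hr)
    · exact Or.inr ⟨a, rfl⟩
  · simp only [reduction, List.mem_singleton, forall_eq]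
    -- A model with the description at the positive example would have a defect there.
    intro M hM h
    obtain ⟨hin, -, hd⟩ := hC.forces M (fun α hα => hM.1 α (by simp [hα])) _ h
    refine hd (hM.1 (startCI c n) (by simp) ⟨hM.2 (.concept 0 0) (by simp),
      mem_inputIs.2 ?_⟩)
    obtain ⟨⟨y, hy⟩, h⟩ := mem_the.1 hin
    exact ⟨y, hy, isList_of_mem_theList (h y hy)⟩
  · simp only [reduction, List.mem_singleton, forall_eq]
    exact fun h => h _ (intended_isModel c n (.run c [n])) (hC.mem_intended _)

/-- The defect concepts do not mention the concept names in the database. -/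
theorem concept_notMem_sig_defect {A : ℕ} (hA : A < 2) (c : Code) :
    Symbol.concept A ∉ (defect c).sig := by
  have h2 : A ≠ testName := hA.ne
  induction c with
  | fix f =>
    have h3 : A ≠ defectName f := by simp only [defectName]; omega
    simpa [defect, sig] using h3
  | _ =>
    simp_all [defect, anyOf, sig, differ, exTail, zero, positive, emptyList, isCons]

theorem concept_notMem_sig_fixDefect {A : ℕ} (hA : A < 2) (f : Code) :
    Symbol.concept A ∉ (fixDefect f).sig := by
  have h2 : A ≠ testName := hA.ne
  simp [fixDefect, anyOf, sig, differ, exTail, zero, positive, concept_notMem_sig_defect hA, h2]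

open Classical in
/-- If some concept separates, the structure in which it fails at the negative example contains the
run of `c` on `[n]`: otherwise the positive example could be moved to the same element, and the
concept names of the knowledge base reinterpreted, without affecting the separating concept. -/
theorem eval_dom_of_separable {c : Code} {n : ℕ} (h : (reduction c n).SeparableWithIndHelpers) :
    (c.eval [n]).Dom := by
  obtain ⟨help, -, hdisj, C, hsig, hpos, hneg⟩ := h
  have hneg := hneg 1 (by simp [reduction])
  simp only [KB.Entails, not_forall] at hneg
  obtain ⟨M, -, hM⟩ := hneg
  by_contra hdom
  -- Without input `[n]` nothing is required of the element. With this input, it can be made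
  -- defective, since a correct run would yield a value of `c` on `[n]`.
  obtain ⟨V, hV, hstart⟩ : ∃ V, IsValid M V ∧
      (M.ind 1 ∈ (inputIs n).ext M → M.ind 1 ∈ (defect c).ext (M.withConcepts V)) := by
    by_cases hin : M.ind 1 ∈ (inputIs n).ext M
    · by_cases hd : Defective M c (M.ind 1)
      · obtain ⟨V, hV, hd⟩ := hd
        exact ⟨V, hV, fun _ => hd⟩
      · obtain ⟨y, hy, hv⟩ := mem_inputIs.1 hin
        obtain ⟨w, hw, -⟩ := sound_of_not_defective hd [n] y hy hv
        exact (hdom (Part.dom_iff_mem.2 ⟨w, hw⟩)).elim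
    · exact ⟨testOnly ∅, isValid_testOnly ∅, fun h => (hin h).elim⟩
  -- `M'` moves the positive example to the negative one and reinterprets only those concept names
  -- that occur in the knowledge base, because helper concept names have to keep their meaning.
  let K := (reduction c n).K
  let U : ℕ → Set M.dom := fun A => if A = 0 then {M.ind 1} else if A = 1 then Set.univ else V A
  let concept' : ℕ → Set M.dom := fun A => if .concept A ∈ K.sig then U A else M.concept A
  let ind' : ℕ → M.dom := fun a => if a = 0 then M.ind 1 else M.ind a
  let M' : Interp := ⟨M.dom, concept', M.role, ind'⟩
  have extU {D : ALCOConcept} (hD : D.sig ⊆ K.sig) (hALC : D.IsALC) :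
      D.ext M' = D.ext (M.withConcepts U) :=
    ext_congr (M := M.withConcepts U) (fun A hA => if_pos (hD hA))
      fun a ha => (ind_notMem_sig_of_isALC hALC ha).elim
  have extV {D : ALCOConcept} (hD : ∀ A < 2, .concept A ∉ D.sig) :
      D.ext (M.withConcepts U) = D.ext (M.withConcepts V) := by
    refine ext_congr (M := M.withConcepts V) (fun A hA => ?_) fun _ _ => rfl
    have h0 : A ≠ 0 := by rintro rfl; exact hD 0 (by omega) hA
    have h1 : A ≠ 1 := by rintro rfl; exact hD 1 (by omega) hA
    simp [U, h0, h1]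
  have hmodel : M'.IsModel K := by
    refine ⟨fun α hα => ?_, fun f hf => ?_⟩
    · have hALC := reduction_isALC c n α hα
      have hsub : α.sig ⊆ K.sig := fun s hs => Or.inl ⟨α, hα, hs⟩
      rw [Interp.SatCI, extU (Set.subset_union_left.trans hsub) hALC.1,
        extU (Set.subset_union_right.trans hsub) hALC.2]
      simp only [K, reduction, List.mem_cons, List.mem_append, List.mem_map] at hα
      rcases hα with rfl | ⟨r, -, rfl⟩ | hα
      · rintro x ⟨hx, hin⟩
        obtain rfl : x = M.ind 1 := hx
        rw [startCI, extV fun A hA => concept_notMem_sig_defect hA c]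
        exact hstart (mem_inputIs.2 ((mem_inputIs (M := M.withConcepts U)).1 hin))
      · exact fun _ _ => trivial
      · obtain ⟨f, rfl⟩ := exists_eq_fixCI_of_mem_fixCIs hα
        change (defect f.fix).ext (M.withConcepts U) ⊆ (fixDefect f).ext (M.withConcepts U)
        rw [extV fun A hA => concept_notMem_sig_fixDefect hA f,
          extV fun A hA => concept_notMem_sig_defect hA f.fix]
        exact hV f
    · have hA {A : ℕ} (h : .concept A A ∈ K.database) : M'.concept A = U A :=
        if_pos (Or.inr ⟨_, h, by simp [Fact.sig]⟩)
      have hf' := hf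
      simp only [K, reduction, List.mem_cons, List.not_mem_nil, or_false] at hf'
      rcases hf' with rfl | rfl
      · change M'.ind 0 ∈ M'.concept 0
        rw [hA hf]
        rfl
      · change M'.ind 1 ∈ M'.concept 1
        rw [hA hf]
        trivial
  have hC : C.ext M' = C.ext M := by
    have hsig' {s : Symbol} (hs : s ∈ C.sig) (hr : ∀ r, s ≠ .role r) : s ∉ K.sig := by
      rcases hsig hs with h | h
      · obtain ⟨r, -, rfl⟩ := List.mem_map.1 h
        exact (hr r rfl).elim
      · exact Set.disjoint_left.1 hdisj h
    refine ext_congr (fun A hA => if_neg (hsig' hA (by simp))) fun a ha => if_neg ?_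
    rintro rfl
    exact hsig' ha (by simp) (ind_mem_sig_reduction.2 (Or.inl rfl))
  have := hpos 0 (by simp [reduction]) M' hmodel
  rw [hC] at this
  exact hM this

theorem separable_iff {c : Code} {n : ℕ} :
    (reduction c n).SeparableWithIndHelpers ↔ (c.eval [n]).Dom :=
  ⟨eval_dom_of_separable, fun h => separable_of_mem_eval (Part.get_mem h)⟩

/-! ### Computability of the reduction -/

theorem primrec_ex (r : ℕ) : Primrec (ex r) := by
  have h : Primrec fun C => equivNat.symm (5 * Nat.pair r (equivNat C) + 6) :=
    Primrec.of_equiv_symm.comp <| Primrec.nat_add.comp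
      (Primrec.nat_mul.comp (Primrec.const 5)
        (Primrec₂.natPair.comp (Primrec.const r) Primrec.of_equiv))
      (Primrec.const 6)
  exact h.of_eq fun C => equivNat.symm_apply_eq.2 rfl

theorem primrec_and : Primrec₂ ALCOConcept.and := by
  have h : Primrec fun p : ALCOConcept × ALCOConcept =>
      equivNat.symm (5 * Nat.pair (equivNat p.1) (equivNat p.2) + 5) :=
    Primrec.of_equiv_symm.comp <| Primrec.nat_add.comp
      (Primrec.nat_mul.comp (Primrec.const 5)
        (Primrec₂.natPair.comp (Primrec.of_equiv.comp Primrec.fst)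
          (Primrec.of_equiv.comp Primrec.snd)))
      (Primrec.const 5)
  exact h.of_eq fun p => equivNat.symm_apply_eq.2 rfl

theorem primrec_num : Primrec num := by
  have h : Primrec (Nat.rec zero fun _ C => ex rolePred C : ℕ → ALCOConcept) :=
    Primrec.nat_rec₁ zero ((primrec_ex rolePred).comp Primrec.snd)
  refine h.of_eq fun n => ?_
  induction n with
  | zero => rfl
  | succ n ih => exact congrArg _ ih

theorem primrec_startCI (c : Code) : Primrec (startCI c) := by
  have h : Primrec inputIs := (primrec_ex _).comp <|
    primrec_and.comp ((primrec_ex _).comp primrec_num) (Primrec.const _)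
  exact (Primrec.of_equiv_symm (e := CI.equivProd)).comp <|
    (primrec_and.comp (Primrec.const (atom 0)) h).pair (Primrec.const (defect c))

theorem primrec_reduction (c : Code) : Primrec (reduction c) :=
  .of_eq ((Primrec.of_equiv_symm (e := Input.equivProd)).comp <| Primrec.pair
    ((Primrec.of_equiv_symm (e := KB.equivProd)).comp <| Primrec.pair
      (Primrec.list_cons.comp (primrec_startCI c) (Primrec.const _)) (Primrec.const _))
    (Primrec.const ([0], [1], sgnRoles.map .role))) fun _ => rfl

/-- Some code computes a function on numbers with undecidable domain. -/
theorem exists_code_not_computablePred :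
    ∃ c : Code, ¬ ComputablePred fun n : ℕ => (c.eval [n]).Dom := by
  let g : ℕ →. ℕ := fun m => (Denumerable.ofNat Nat.Partrec.Code m).eval 0
  have hg : Partrec g :=
    Nat.Partrec.Code.eval_part.comp (Computable.ofNat _) (Computable.const 0)
  obtain ⟨c, hc⟩ := Code.exists_code (Nat.Partrec'.part_iff₁.2 hg)
  refine ⟨c, fun h => ComputablePred.halting_problem 0 ?_⟩
  obtain ⟨f, hf, hf'⟩ := ComputablePred.computable_iff.1 h
  refine ComputablePred.computable_iff.2
    ⟨fun d => f (Encodable.encode d), hf.comp Computable.encode, funext fun d => ?_⟩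
  have heval : c.eval [Encodable.encode d] = pure <$> g (Encodable.encode d) :=
    hc (Encodable.encode d ::ᵥ List.Vector.nil)
  rw [← congrFun hf' (Encodable.encode d), heval]
  simp [g]

end DL

/-- Undecidability: no computable function decides, for every labeled ALC-knowledge base
`(K, P, N)` and signature `Σ ⊆ sig(K)`, whether `(K, P, N)` is projectively ALCO(Σ)-separable with
concept names and individual names as helper symbols. -/
theorem mainTheorem11 :
    ¬ ∃ decide : DL.Input → Bool, Computable decide ∧
      ∀ I : DL.Input, I.Valid → (decide I = true ↔ I.SeparableWithIndHelpers) := by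
  rintro ⟨decide, hcomp, hdecide⟩
  obtain ⟨c, hc⟩ := DL.exists_code_not_computablePred
  refine hc (ComputablePred.computable_iff.2
    ⟨fun n => decide (DL.reduction c n), hcomp.comp (DL.primrec_reduction c).to_comp,
      funext fun n => ?_⟩)
  rw [← DL.separable_iff, hdecide _ (DL.reduction_valid c n)]
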